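/- Let $\mathfrak g$ be a finite-dimensional complex simple Lie algebra with Cartan subalgebra $\mathfrak h$, a system of positive roots $\Delta_+$, highest root $\theta$, and the invariant form $(\cdot\mid\cdot)$ proportional to the Killing form with $(\theta\mid\theta)=2$. The affine-Virasoro algebra is $$\mathfrak L=\mathfrak L(\mathfrak g)=\bigoplus_{n\in\mathbb Z}\mathfrak g(n)\oplus\bigoplus_{n\in\mathbb Z}\mathbb C d_n\oplus\mathbb C\mathbf k\oplus\mathbb C\mathbf c,$$ where $\mathfrak g(n)=\{x(n): x\in\mathfrak g\}$ is a copy of $\mathfrak g$, $\mathbf k,\mathbf c$ are central and $$[x(m),y(n)]=[x,y](m+n)+m(x\mid y)\delta_{m+n,0}\mathbf k,\qquad [d_n,x(m)]=m\,x(m+n),$$ $$[d_m,d_n]=(n-m)d_{m+n}+\delta_{m+n,0}\tfrac{m^3-m}{12}\mathbf c .$$ For $\lambda\in\mathfrak h^*$ and $l,k,c\in\mathbb C$ let $M(\lambda,l,k,c)$ be the Verma module, that is, the $\mathfrak L$-module generated by a vector $u$ subject to the relations $h(0)u=\lambda(h)u$ for $h\in\mathfrak h$, $d_0u=lu$, $\mathbf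 ku=ku$, $\mathbf cu=cu$, $\mathfrak g_\alpha(0)u=0$ for $\alpha\in\Delta_+$, and $x(n)u=d_nu=0$ for $x\in\mathfrak g$, $n\ge 1$. Let $L=L(\lambda,l,k,c)$ be its quotient by its maximal proper submodule. A vector $w\in L$ has degree $p\in\mathbb Z$ if $d_0w=(l+p)w$; $L$ is the direct sum of its subspaces of degree $p\in\mathbb Z$. Let $L(\mu)$ be the finite-dimensional irreducible $\mathfrak g$-module of highest weight $\mu$, and for $a,b\in\mathbb C$ let $L_{a,b}(\mu)=L(\mu)\otimes\mathbb C[t^{\pm1}]$ be the loop module, on which $\mathbf k,\mathbf c$ act by $0$ and $$d_m(v\otimes t^n)=(a+bm+n)\,v\otimes t^{m+n},\qquad x(m)(v\otimes t^n)=(xv)\otimes t^{m+n}.$$ Let $L_{\lambda,l,k,c}^{\mu,a,b}$ be the vector space $L\otimes L(\mu)\otimes\mathbb C[t^{\pm1}]$ with the "shifted" $\mathfrak L$-action in which $\mathbf k,\mathbf c$ act by the scalars $k,c$ and, for $w\in L$ of degree $p$, $$d_m(w\otimes v\otimes t^n)=(d_mw+(a+n-p+bm)w)\otimes v\otimes t^{m+n},$$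 $$x(m)(w\otimes v\otimes t^n)=(x(m)w\otimes v+w\otimes xv)\otimes t^{m+n}.$$ **Theorem.** Assume $\mu\neq0$. Then: 1. there is an isomorphism of $\mathfrak L$-modules $L(\lambda,l,k,c)\otimes L_{a,b}(\mu)\to L_{\lambda,l,k,c}^{\mu,a,b}$ with $w\otimes(v\otimes t^n)\mapsto w\otimes v\otimes t^{n+p}$ for $w$ of degree $p$; 2. $\operatorname{End}_{\mathfrak L}\big(L_{\lambda,l,k,c}^{\mu,a,b}\big)\cong\mathbb C$ and $\operatorname{End}_{\mathfrak L}\big(L(\lambda,l,k,c)\otimes L_{a,b}(\mu)\big)\cong\mathbb C$ as algebras; 3. both modules $L_{\lambda,l,k,c}^{\mu,a,b}$ and $L(\lambda,l,k,c)\otimes L_{a,b}(\mu)$ are indecomposable, i.e. nonzero and not a direct sum of two nonzero submodules. -/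

import Mathlib

open Module TensorProduct LieAlgebra LieAlgebra.IsKilling

universe u v w

noncomputable section

set_option linter.unusedSectionVars false

/-! ### The finite-dimensional simple Lie algebra -/

section Simple

variable {g : Type u} [LieRing g] [LieAlgebra ℂ g] [FiniteDimensional ℂ g]
  [LieAlgebra.IsSimple ℂ g] {H : LieSubalgebra ℂ g} [H.IsCartanSubalgebra]

/-- `θ` is the highest root with respect to the positive system given by the base `Φ`:
the root of largest height. -/
def IsHighestRoot (Φ : (rootSystem H).Base) (θ : H.root) : Prop :=
  ∀ α : H.root, Φ.height α ≤ Φ.height θ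

/-- The Killing form of `g`, rescaled so that `(θ ∣ θ) = 2` for the form induced on the dual of the
Cartan subalgebra.  If `t` is the element of `H` that represents `θ` through the Killing form
`κ`, the form induced by `κ` has `(θ ∣ θ) = κ(t, t) = θ(t)`; the form induced by `s • κ` has
`(θ ∣ θ) = θ(t) / s`, so that the scalar is `s = θ(t) / 2`. -/
def normalizedForm (θ : H.root) : LinearMap.BilinForm ℂ g :=
  (θ.1 ((cartanEquivDual H).symm (θ.1.toLinear ℂ H g)) / 2) • killingForm ℂ g

theorem normalizedForm_symm (θ : H.root) (x y : g) :
    normalizedForm θ x y = normalizedForm θ y x := by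
  simp only [normalizedForm, LinearMap.smul_apply]
  rw [LieModule.traceForm_comm]

theorem normalizedForm_lie (θ : H.root) (x y z : g) :
    normalizedForm θ ⁅x, y⁆ z = normalizedForm θ x ⁅y, z⁆ := by
  simp only [normalizedForm, LinearMap.smul_apply]
  rw [LieModule.traceForm_apply_lie_apply]

/-- `v` is a highest weight vector of weight `μ` (with respect to the positive system of `Φ`) in the
`g`-module `V`. -/
structure IsHighestWeightVector (Φ : (rootSystem H).Base) {V : Type v} [AddCommGroup V]
    [Module ℂ V] [LieRingModule g V] [LieModule ℂ g V] (μ : Dual ℂ H) (v : V) : Prop where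
  ne_zero : v ≠ 0
  weight : ∀ h : H, ⁅(h : g), v⁆ = μ h • v
  raising : ∀ α : H.root, Φ.IsPos α → ∀ e ∈ rootSpace H α.1, ⁅e, v⁆ = 0

/-! ### The affine-Virasoro algebra -/

/-- The space `(⨁ₙ (g(n) ⊕ ℂ dₙ)) ⊕ ℂ 𝐤 ⊕ ℂ 𝐜` underlying the affine-Virasoro algebra.  The element
`x(n) + s dₙ` of degree `n` is `Finsupp.single n (x, s)` in the first component. The highest root
`θ` enters the Lie bracket through the normalised Killing form. -/
def AffineVirasoro (_θ : H.root) : Type u := (ℤ →₀ g × ℂ) × ℂ × ℂ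

namespace AffineVirasoro

variable (θ : H.root)

instance : AddCommGroup (AffineVirasoro θ) := inferInstanceAs (AddCommGroup ((ℤ →₀ g × ℂ) × ℂ × ℂ))

instance : Module ℂ (AffineVirasoro θ) := inferInstanceAs (Module ℂ ((ℤ →₀ g × ℂ) × ℂ × ℂ))

/-- The inclusion of the homogeneous component `g(n) ⊕ ℂ dₙ`. -/
def hom (n : ℤ) : (g × ℂ) →ₗ[ℂ] AffineVirasoro θ :=
  LinearMap.inl ℂ (ℤ →₀ g × ℂ) (ℂ × ℂ) ∘ₗ Finsupp.lsingle n

/-- The element `x(n) = x ⊗ tⁿ`. -/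
def cur (n : ℤ) (x : g) : AffineVirasoro θ := hom θ n (x, 0)

/-- The element `dₙ`. -/
def vir (n : ℤ) : AffineVirasoro θ := hom θ n (0, 1)

/-- The central element `𝐤`. -/
def K : AffineVirasoro θ := ((0 : ℤ →₀ g × ℂ), (1 : ℂ), (0 : ℂ))

/-- The central element `𝐜`. -/
def C : AffineVirasoro θ := ((0 : ℤ →₀ g × ℂ), (0 : ℂ), (1 : ℂ))

/-- The bracket of `x(m) + s dₘ` and `y(n) + t dₙ`. -/
def homBracket (m n : ℤ) : (g × ℂ) →ₗ[ℂ] (g × ℂ) →ₗ[ℂ] AffineVirasoro θ :=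
  LinearMap.mk₂ ℂ
    (fun X Y => hom θ (m + n)
        (⁅X.1, Y.1⁆ + ((n : ℂ) * X.2) • Y.1 - ((m : ℂ) * Y.2) • X.1,
          ((n : ℂ) - m) * (X.2 * Y.2))
      + (if m + n = 0 then (m : ℂ) * normalizedForm θ X.1 Y.1 else 0) • K θ
      + (if m + n = 0 then ((m : ℂ) ^ 3 - m) / 12 * (X.2 * Y.2) else 0) • C θ)
    (by
      intro X X' Y
      have : ∀ (p q : g × ℂ), hom θ (m + n) p + hom θ (m + n) q = hom θ (m + n) (p + q) :=
        fun p q => (map_add _ _ _).symm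
      split_ifs
      · rw [add_add_add_comm, add_add_add_comm (hom θ (m + n) _), this, ← add_smul, ← add_smul]
        congr 2
        · congr 1
          ext
          · simp; module
          · simp; ring
        · simp; ring_nf
        · simp; ring_nf
      · simp only [zero_smul, add_zero, this]
        congr 1
        ext
        · simp; module
        · simp; ring)
    (by
      intro r X Y
      split_ifs
      · simp only [smul_add, smul_smul, ← map_smul]
        congr 2
        · congr 1
          ext
          · simp; module
          · simp; ring
        · simp; ring_nf
        · simp; ring_nf
      · simp only [zero_smul, add_zero, ← map_smul]
        congr 1
        ext
        · simp; module
        · simp; ring)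
    (by
      intro X Y Y'
      have : ∀ (p q : g × ℂ), hom θ (m + n) p + hom θ (m + n) q = hom θ (m + n) (p + q) :=
        fun p q => (map_add _ _ _).symm
      split_ifs
      · rw [add_add_add_comm, add_add_add_comm (hom θ (m + n) _), this, ← add_smul, ← add_smul]
        congr 2
        · congr 1
          ext
          · simp; module
          · simp; ring
        · simp; ring_nf
        · simp; ring_nf
      · simp only [zero_smul, add_zero, this]
        congr 1
        ext
        · simp; module
        · simp; ring)
    (by
      intro r X Y
      split_ifs
      · simp only [smul_add, smul_smul, ← map_smul]
        congr 2
        · congr 1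
          ext
          · simp; module
          · simp; ring
        · simp; ring_nf
        · simp; ring_nf
      · simp only [zero_smul, add_zero, ← map_smul]
        congr 1
        ext
        · simp; module
        · simp; ring)

/-- The projection to `⨁ₙ (g(n) ⊕ ℂ dₙ)`. -/
def proj : AffineVirasoro θ →ₗ[ℂ] (ℤ →₀ g × ℂ) := LinearMap.fst ℂ (ℤ →₀ g × ℂ) (ℂ × ℂ)

/-- The bilinear extension of `homBracket` for which `𝐤` and `𝐜` are central. -/
def bracketₗ : AffineVirasoro θ →ₗ[ℂ] AffineVirasoro θ →ₗ[ℂ] AffineVirasoro θ :=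
  (Finsupp.lsum ℂ fun m : ℤ => LinearMap.flip
    (Finsupp.lsum ℂ fun n : ℤ => LinearMap.flip (homBracket θ m n))).compl₁₂ (proj θ) (proj θ)

theorem hom_ext {N : Type*} [AddCommGroup N] [Module ℂ N] {f f' : AffineVirasoro θ →ₗ[ℂ] N}
    (h : ∀ n X, f (hom θ n X) = f' (hom θ n X)) (hK : f (K θ) = f' (K θ))
    (hC : f (C θ) = f' (C θ)) : f = f' := by
  apply LinearMap.prod_ext (f := (f : (ℤ →₀ g × ℂ) × ℂ × ℂ →ₗ[ℂ] N))
    (g := (f' : (ℤ →₀ g × ℂ) × ℂ × ℂ →ₗ[ℂ] N))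
  · apply Finsupp.lhom_ext'
    intro n
    apply LinearMap.ext
    intro X
    exact h n X
  · apply LinearMap.prod_ext
    · exact LinearMap.ext_ring hK
    · exact LinearMap.ext_ring hC

theorem proj_hom (n : ℤ) (X : g × ℂ) : proj θ (hom θ n X) = Finsupp.single n X := rfl
theorem proj_K : proj θ (K θ) = 0 := rfl
theorem proj_C : proj θ (C θ) = 0 := rfl

theorem bracketₗ_hom (m n : ℤ) (X Y : g × ℂ) :
    bracketₗ θ (hom θ m X) (hom θ n Y) = homBracket θ m n X Y := by
  simp [bracketₗ, proj_hom]

theorem bracketₗ_K (y : AffineVirasoro θ) : bracketₗ θ (K θ) y = 0 := by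
  simp [bracketₗ, proj_K]
theorem bracketₗ_C (y : AffineVirasoro θ) : bracketₗ θ (C θ) y = 0 := by
  simp [bracketₗ, proj_C]
theorem bracketₗ_K' (y : AffineVirasoro θ) : bracketₗ θ y (K θ) = 0 := by
  simp [bracketₗ, proj_K]
theorem bracketₗ_C' (y : AffineVirasoro θ) : bracketₗ θ y (C θ) = 0 := by
  simp [bracketₗ, proj_C]

theorem homBracket_apply (m n : ℤ) (X Y : g × ℂ) :
    homBracket θ m n X Y = hom θ (m + n)
        (⁅X.1, Y.1⁆ + ((n : ℂ) * X.2) • Y.1 - ((m : ℂ) * Y.2) • X.1,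
          ((n : ℂ) - m) * (X.2 * Y.2))
      + (if m + n = 0 then (m : ℂ) * normalizedForm θ X.1 Y.1 else 0) • K θ
      + (if m + n = 0 then ((m : ℂ) ^ 3 - m) / 12 * (X.2 * Y.2) else 0) • C θ := rfl

theorem bracketₗ_skew (x y : AffineVirasoro θ) : bracketₗ θ x y = - bracketₗ θ y x := by
  suffices h : bracketₗ θ = -(bracketₗ θ).flip by
    conv_lhs => rw [h]
    rfl
  apply hom_ext
  · intro m X
    apply hom_ext
    · intro n Y
      simp only [LinearMap.neg_apply, LinearMap.flip_apply, bracketₗ_hom, homBracket_apply]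
      rw [add_comm n m, neg_add, neg_add, ← map_neg, ← neg_smul, ← neg_smul]
      congr 2
      · congr 1
        ext
        · simp only [Prod.fst_neg]
          rw [← lie_skew]
          module
        · simp only [Prod.snd_neg]
          ring
      · congr 1
        split_ifs with h
        · obtain rfl : n = -m := by omega
          rw [normalizedForm_symm]; push_cast; ring
        · simp
      · congr 1
        split_ifs with h
        · obtain rfl : n = -m := by omega
          push_cast; ring
        · simp
    · simp [bracketₗ_K, bracketₗ_K']
    · simp [bracketₗ_C, bracketₗ_C']
  · ext : 1; simp [bracketₗ_K, bracketₗ_K']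
  · ext : 1; simp [bracketₗ_C, bracketₗ_C']

theorem bracketₗ_jacobi_hom (m n p : ℤ) (X Y Z : g × ℂ) :
    bracketₗ θ (hom θ m X) (bracketₗ θ (hom θ n Y) (hom θ p Z)) =
      bracketₗ θ (bracketₗ θ (hom θ m X) (hom θ n Y)) (hom θ p Z) +
      bracketₗ θ (hom θ n Y) (bracketₗ θ (hom θ m X) (hom θ p Z)) := by
  simp only [bracketₗ_hom, homBracket_apply, map_add, map_smul, LinearMap.add_apply,
    LinearMap.smul_apply, bracketₗ_K, bracketₗ_C, bracketₗ_K', bracketₗ_C', smul_zero, add_zero]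
  rw [add_add_add_comm (hom θ (m + n + p) _ + _), add_add_add_comm (hom θ (m + n + p) _),
    ← add_smul, ← add_smul, add_left_comm n m p, ← add_assoc m n p, ← map_add]
  congr 2
  · congr 1
    ext
    · simp only [Prod.fst_add, lie_add, lie_sub, add_lie, sub_lie, lie_smul, smul_lie, smul_add,
        smul_sub, leibniz_lie X.1 Y.1 Z.1]
      rw [← lie_skew Y.1 X.1]
      push_cast
      module
    · simp only [Prod.snd_add]
      push_cast
      ring
  · congr 1
    split_ifs with h
    · obtain rfl : p = -m - n := by omega
      simp only [map_add, map_sub, map_smul, LinearMap.add_apply, LinearMap.sub_apply,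
        LinearMap.smul_apply, smul_eq_mul]
      have h1 : normalizedForm θ Y.1 ⁅X.1, Z.1⁆ = - normalizedForm θ X.1 ⁅Y.1, Z.1⁆ := by
        rw [← normalizedForm_lie, ← normalizedForm_lie, ← lie_skew Y.1 X.1, map_neg,
          LinearMap.neg_apply]
      rw [h1, normalizedForm_lie, normalizedForm_symm θ Y.1 X.1]
      push_cast
      ring
    · simp
  · congr 1
    split_ifs with h
    · obtain rfl : p = -m - n := by omega
      push_cast
      ring
    · simp

theorem bracketₗ_jacobi (x y z : AffineVirasoro θ) :
    bracketₗ θ x (bracketₗ θ y z) =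
      bracketₗ θ (bracketₗ θ x y) z + bracketₗ θ y (bracketₗ θ x z) := by
  let B := bracketₗ θ
  let lhs : AffineVirasoro θ →ₗ[ℂ] AffineVirasoro θ →ₗ[ℂ] AffineVirasoro θ →ₗ[ℂ] AffineVirasoro θ :=
    LinearMap.mk₂ ℂ (fun x y => B x ∘ₗ B y - B (B x y) - B y ∘ₗ B x)
      (by intros; ext : 1; simp; abel) (by intros; ext : 1; simp [smul_sub])
      (by intros; ext : 1; simp; abel) (by intros; ext : 1; simp [smul_sub])
  suffices h : lhs = 0 by
    have h2 := LinearMap.congr_fun (LinearMap.congr_fun₂ h x y) z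
    have h3 : B x (B y z) - B (B x y) z - B y (B x z) = 0 := h2
    rw [sub_sub, sub_eq_zero] at h3
    exact h3
  have e : ∀ x y z, lhs x y z = B x (B y z) - B (B x y) z - B y (B x z) := fun _ _ _ => rfl
  apply hom_ext
  · intro m X
    apply hom_ext
    · intro n Y
      apply hom_ext
      · intro p Z
        rw [e]
        simp only [B]
        rw [bracketₗ_jacobi_hom]
        simp
      · rw [e]; simp [B, bracketₗ_K']
      · rw [e]; simp [B, bracketₗ_C']
    · ext z : 1; rw [e]; simp [B, bracketₗ_K, bracketₗ_K']
    · ext z : 1; rw [e]; simp [B, bracketₗ_C, bracketₗ_C']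
  · ext y z : 2; rw [e]; simp [B, bracketₗ_K]
  · ext y z : 2; rw [e]; simp [B, bracketₗ_C]

instance : LieRing (AffineVirasoro θ) where
  bracket x y := bracketₗ θ x y
  add_lie x y z := by simp
  lie_add x y z := by simp
  lie_self x := by
    have h : (2 : ℂ) • bracketₗ θ x x = 0 := by
      rw [two_smul]
      nth_rewrite 1 [bracketₗ_skew θ x x]
      exact neg_add_cancel _
    exact (smul_eq_zero.mp h).resolve_left two_ne_zero
  leibniz_lie x y z := bracketₗ_jacobi θ x y z

instance : LieAlgebra ℂ (AffineVirasoro θ) where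
  lie_smul r x y := (bracketₗ θ x).map_smul r y

theorem lie_def (x y : AffineVirasoro θ) : ⁅x, y⁆ = bracketₗ θ x y := rfl

/-! The defining relations of the affine-Virasoro algebra. -/

theorem lie_cur_cur (m n : ℤ) (x y : g) :
    ⁅cur θ m x, cur θ n y⁆ = cur θ (m + n) ⁅x, y⁆ +
      (if m + n = 0 then (m : ℂ) * normalizedForm θ x y else 0) • K θ := by
  simp [lie_def, cur, bracketₗ_hom, homBracket_apply]

theorem lie_vir_vir (m n : ℤ) :
    ⁅vir θ m, vir θ n⁆ = ((n : ℂ) - m) • vir θ (m + n) +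
      (if m + n = 0 then ((m : ℂ) ^ 3 - m) / 12 else 0) • C θ := by
  simp [lie_def, vir, bracketₗ_hom, homBracket_apply, ← map_smul]

theorem lie_vir_cur (n m : ℤ) (x : g) :
    ⁅vir θ n, cur θ m x⁆ = (m : ℂ) • cur θ (m + n) x := by
  simp [lie_def, vir, cur, bracketₗ_hom, homBracket_apply, ← map_smul, add_comm]

theorem lie_K (x : AffineVirasoro θ) : ⁅x, K θ⁆ = 0 := bracketₗ_K' θ x

theorem lie_C (x : AffineVirasoro θ) : ⁅x, C θ⁆ = 0 := bracketₗ_C' θ x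

/-- The linear map on the affine-Virasoro algebra with given values on the homogeneous components,
on `𝐤` and on `𝐜`. -/
def lift {N : Type*} [AddCommGroup N] [Module ℂ N] (f : ℤ → (g × ℂ) →ₗ[ℂ] N) (k c : N) :
    AffineVirasoro θ →ₗ[ℂ] N :=
  LinearMap.coprod (M := ℤ →₀ g × ℂ) (M₂ := ℂ × ℂ) (Finsupp.lsum ℂ f)
    (LinearMap.coprod (LinearMap.toSpanSingleton ℂ N k) (LinearMap.toSpanSingleton ℂ N c))

theorem lift_hom {N : Type*} [AddCommGroup N] [Module ℂ N] (f : ℤ → (g × ℂ) →ₗ[ℂ] N) (k c : N)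
    (n : ℤ) (X : g × ℂ) : lift θ f k c (hom θ n X) = f n X := by
  change Finsupp.lsum ℂ f (Finsupp.single n X) + ((0 : ℂ) • k + (0 : ℂ) • c) = _
  simp

theorem lift_K {N : Type*} [AddCommGroup N] [Module ℂ N] (f : ℤ → (g × ℂ) →ₗ[ℂ] N) (k c : N) :
    lift θ f k c (K θ) = k := by
  change Finsupp.lsum ℂ f 0 + ((1 : ℂ) • k + (0 : ℂ) • c) = _
  simp

theorem lift_C {N : Type*} [AddCommGroup N] [Module ℂ N] (f : ℤ → (g × ℂ) →ₗ[ℂ] N) (k c : N) :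
    lift θ f k c (C θ) = c := by
  change Finsupp.lsum ℂ f 0 + ((0 : ℂ) • k + (1 : ℂ) • c) = _
  simp

/-- A linear map from the affine-Virasoro algebra to the endomorphisms of a vector space that respects
the bracket on generators respects the bracket. -/
theorem rep_lie {M : Type*} [AddCommGroup M] [Module ℂ M] (ρ : AffineVirasoro θ →ₗ[ℂ] End ℂ M)
    (h : ∀ m n X Y, ρ ⁅hom θ m X, hom θ n Y⁆ =
      ρ (hom θ m X) * ρ (hom θ n Y) - ρ (hom θ n Y) * ρ (hom θ m X))
    (hK : ∀ n X, ρ (K θ) * ρ (hom θ n X) = ρ (hom θ n X) * ρ (K θ))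
    (hC : ∀ n X, ρ (C θ) * ρ (hom θ n X) = ρ (hom θ n X) * ρ (C θ))
    (hKC : ρ (K θ) * ρ (C θ) = ρ (C θ) * ρ (K θ)) (x y : AffineVirasoro θ) :
    ρ ⁅x, y⁆ = ρ x * ρ y - ρ y * ρ x := by
  let F : AffineVirasoro θ →ₗ[ℂ] AffineVirasoro θ →ₗ[ℂ] End ℂ M :=
    LinearMap.mk₂ ℂ (fun x y => ρ (bracketₗ θ x y) - (ρ x * ρ y - ρ y * ρ x))
      (by intros; simp [add_mul, mul_add]; abel) (by intros; simp [smul_sub])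
      (by intros; simp [add_mul, mul_add]; abel) (by intros; simp [smul_sub])
  suffices hF : F = 0 by
    have h2 : F x y = 0 := by rw [hF]; rfl
    exact sub_eq_zero.mp h2
  have e : ∀ x y, F x y = ρ (bracketₗ θ x y) - (ρ x * ρ y - ρ y * ρ x) := fun _ _ => rfl
  apply hom_ext
  · intro m X
    apply hom_ext
    · intro n Y
      rw [e, ← lie_def, h]; simp
    · rw [e, bracketₗ_K', hK]; simp
    · rw [e, bracketₗ_C', hC]; simp
  · apply hom_ext
    · intro n X; rw [e, bracketₗ_K, hK]; simp
    · rw [e, bracketₗ_K]; simp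
    · rw [e, bracketₗ_K, hKC]; simp
  · apply hom_ext
    · intro n X; rw [e, bracketₗ_C, hC]; simp
    · rw [e, bracketₗ_C, hKC]; simp
    · rw [e, bracketₗ_C]; simp

end AffineVirasoro

/-! ### Verma modules -/

open AffineVirasoro

/-- The generators of the left ideal of the universal enveloping algebra that annihilates the
highest weight vector `u` of the Verma module:  `h u = λ(h) u`, `d₀ u = l u`, `𝐤 u = k u`,
`𝐜 u = c u`, `g_α u = 0` for positive roots `α`, and `x(n) u = dₙ u = 0` for `n > 0`. -/
inductive VermaRel (Φ : (rootSystem H).Base) (θ : H.root) (lam : Dual ℂ H) (l k c : ℂ) :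
    UniversalEnvelopingAlgebra ℂ (AffineVirasoro θ) → Prop
  | cartan (h : H) : VermaRel Φ θ lam l k c
      (UniversalEnvelopingAlgebra.ι ℂ (cur θ 0 (h : g)) - algebraMap ℂ _ (lam h))
  | d_zero : VermaRel Φ θ lam l k c (UniversalEnvelopingAlgebra.ι ℂ (vir θ 0) - algebraMap ℂ _ l)
  | level : VermaRel Φ θ lam l k c (UniversalEnvelopingAlgebra.ι ℂ (K θ) - algebraMap ℂ _ k)
  | charge : VermaRel Φ θ lam l k c (UniversalEnvelopingAlgebra.ι ℂ (C θ) - algebraMap ℂ _ c)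
  | raising (α : H.root) (hα : Φ.IsPos α) (e : g) (he : e ∈ rootSpace H α.1) :
      VermaRel Φ θ lam l k c (UniversalEnvelopingAlgebra.ι ℂ (cur θ 0 e))
  | cur_pos (n : ℤ) (hn : 0 < n) (x : g) :
      VermaRel Φ θ lam l k c (UniversalEnvelopingAlgebra.ι ℂ (cur θ n x))
  | vir_pos (n : ℤ) (hn : 0 < n) :
      VermaRel Φ θ lam l k c (UniversalEnvelopingAlgebra.ι ℂ (vir θ n))

/-- The left ideal that annihilates the highest weight vector of the Verma module. -/
def vermaIdeal (Φ : (rootSystem H).Base) (θ : H.root) (lam : Dual ℂ H) (l k c : ℂ) :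
    Submodule (UniversalEnvelopingAlgebra ℂ (AffineVirasoro θ))
      (UniversalEnvelopingAlgebra ℂ (AffineVirasoro θ)) :=
  Submodule.span _ {y | VermaRel Φ θ lam l k c y}

/-- The Verma module `M(λ, l, k, c) = U(𝔏) ⊗_{U(ℋ ⊕ 𝔏₊)} ℂ u`, realised as the quotient of `U(𝔏)` by
the left ideal that annihilates `u`. -/
def VermaModule (Φ : (rootSystem H).Base) (θ : H.root) (lam : Dual ℂ H) (l k c : ℂ) : Type u :=
  UniversalEnvelopingAlgebra ℂ (AffineVirasoro θ) ⧸ vermaIdeal Φ θ lam l k c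

namespace VermaModule

variable (Φ : (rootSystem H).Base) (θ : H.root) (lam : Dual ℂ H) (l k c : ℂ)

instance : AddCommGroup (VermaModule Φ θ lam l k c) :=
  inferInstanceAs (AddCommGroup (_ ⧸ vermaIdeal Φ θ lam l k c))

instance : Module (UniversalEnvelopingAlgebra ℂ (AffineVirasoro θ)) (VermaModule Φ θ lam l k c) :=
  inferInstanceAs (Module _ (_ ⧸ vermaIdeal Φ θ lam l k c))

instance : Module ℂ (VermaModule Φ θ lam l k c) :=
  inferInstanceAs (Module ℂ (_ ⧸ vermaIdeal Φ θ lam l k c))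

instance : IsScalarTower ℂ (UniversalEnvelopingAlgebra ℂ (AffineVirasoro θ))
    (VermaModule Φ θ lam l k c) :=
  inferInstanceAs (IsScalarTower ℂ _ (_ ⧸ vermaIdeal Φ θ lam l k c))

/-- The Lie algebra acts through its universal enveloping algebra. -/
instance : LieRingModule (AffineVirasoro θ) (VermaModule Φ θ lam l k c) where
  bracket x m := UniversalEnvelopingAlgebra.ι ℂ x • m
  add_lie x y m := by rw [map_add, add_smul]
  lie_add x m n := smul_add _ _ _
  leibniz_lie x y m := by
    let _ : LieRing (UniversalEnvelopingAlgebra ℂ (AffineVirasoro θ)) := LieRing.ofAssociativeRing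
    rw [LieHom.map_lie, LieRing.of_associative_ring_bracket, sub_smul, mul_smul, mul_smul]
    abel

theorem lie_def (x : AffineVirasoro θ) (m : VermaModule Φ θ lam l k c) :
    ⁅x, m⁆ = UniversalEnvelopingAlgebra.ι ℂ x • m := rfl

instance : LieModule ℂ (AffineVirasoro θ) (VermaModule Φ θ lam l k c) where
  smul_lie r x m := by rw [lie_def, lie_def, map_smul, smul_assoc]
  lie_smul r x m := by
    rw [lie_def, lie_def]
    exact smul_algebra_smul_comm r _ m

/-- The highest weight vector `u`. -/
def vac : VermaModule Φ θ lam l k c := Submodule.Quotient.mk 1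

end VermaModule

/-! ### Loop modules -/

/-- The space `V ⊗ ℂ[t, t⁻¹]` underlying the loop module with parameters `a, b`;
`v ⊗ tⁿ` is `Finsupp.single n v`. -/
def LoopModule (_a _b : ℂ) (V : Type v) [AddCommGroup V] : Type v := ℤ →₀ V

namespace LoopModule

variable (a b : ℂ) (V : Type v) [AddCommGroup V] [Module ℂ V] [LieRingModule g V] [LieModule ℂ g V]

instance : AddCommGroup (LoopModule a b V) := inferInstanceAs (AddCommGroup (ℤ →₀ V))

instance : Module ℂ (LoopModule a b V) := inferInstanceAs (Module ℂ (ℤ →₀ V))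

variable {V} in
/-- The element `v ⊗ tⁿ`. -/
def mon (n : ℤ) : V →ₗ[ℂ] LoopModule a b V := Finsupp.lsingle n

variable {V} in
/-- The linear map on the loop module with given values on the elements `v ⊗ tⁿ`. -/
def lift {N : Type*} [AddCommGroup N] [Module ℂ N] (f : ℤ → V →ₗ[ℂ] N) : LoopModule a b V →ₗ[ℂ] N :=
  Finsupp.lsum ℂ f

variable {V} in
theorem lift_mon {N : Type*} [AddCommGroup N] [Module ℂ N] (f : ℤ → V →ₗ[ℂ] N) (n : ℤ) (v : V) :
    lift a b f (mon a b n v) = f n v :=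
  Finsupp.lsum_single ℂ f n v

variable {V} in
theorem mon_ext {N : Type*} [AddCommGroup N] [Module ℂ N] {f f' : LoopModule a b V →ₗ[ℂ] N}
    (h : ∀ n v, f (mon a b n v) = f' (mon a b n v)) : f = f' :=
  Finsupp.lhom_ext h

variable (θ : H.root)

/-- The action of `x(m) + s dₘ`: it maps `v ⊗ tⁿ` to `(x v + s (a + b m + n) v) ⊗ t^(m+n)`. -/
def homAct (m : ℤ) : (g × ℂ) →ₗ[ℂ] End ℂ (LoopModule a b V) where
  toFun X := lift a b fun n : ℤ =>
    mon a b (m + n) ∘ₗ (LieModule.toEnd ℂ g V X.1 + (X.2 * (a + b * m + n)) • LinearMap.id)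
  map_add' X Y := by
    apply mon_ext
    intro n v
    rw [LinearMap.add_apply]
    simp only [lift_mon, LinearMap.comp_apply, ← map_add]
    congr 1
    simp
    module
  map_smul' r X := by
    apply mon_ext
    intro n v
    rw [LinearMap.smul_apply]
    simp only [lift_mon, LinearMap.comp_apply, ← map_smul]
    congr 1
    simp
    module

/-- The action of the affine-Virasoro algebra, with `𝐤` and `𝐜` acting by zero. -/
def act : AffineVirasoro θ →ₗ[ℂ] End ℂ (LoopModule a b V) :=
  AffineVirasoro.lift θ (homAct a b V) 0 0

theorem act_hom (m n : ℤ) (X : g × ℂ) (v : V) :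
    act a b V θ (hom θ m X) (mon a b n v) =
      mon a b (m + n) (⁅X.1, v⁆ + (X.2 * (a + b * m + n)) • v) := by
  rw [act, lift_hom]
  exact lift_mon a b _ n v

theorem act_K : act a b V θ (K θ) = 0 := lift_K ..

theorem act_C : act a b V θ (C θ) = 0 := lift_C ..

theorem act_lie (x y : AffineVirasoro θ) :
    act a b V θ ⁅x, y⁆ = act a b V θ x * act a b V θ y - act a b V θ y * act a b V θ x := by
  apply rep_lie
  · intro m n X Y
    apply mon_ext
    intro p v
    change act a b V θ _ (mon a b p v) = act a b V θ _ (act a b V θ _ (mon a b p v)) -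
      act a b V θ _ (act a b V θ _ (mon a b p v))
    rw [AffineVirasoro.lie_def, bracketₗ_hom, homBracket_apply]
    simp only [map_add (act a b V θ), map_smul (act a b V θ), act_K, act_C, smul_zero, add_zero,
      act_hom]
    rw [add_left_comm n m p, ← add_assoc m n p, ← map_sub]
    congr 1
    simp only [add_lie, sub_lie, lie_add, smul_lie, lie_smul, lie_lie]
    push_cast
    module
  · intro n X; simp [act_K]
  · intro n X; simp [act_C]
  · simp [act_K]

instance : LieRingModule (AffineVirasoro θ) (LoopModule a b V) where
  bracket x w := act a b V θ x w
  add_lie x y w := by simp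
  lie_add x w w' := by simp
  leibniz_lie x y w := by rw [act_lie]; simp

theorem lie_def (x : AffineVirasoro θ) (w : LoopModule a b V) : ⁅x, w⁆ = act a b V θ x w := rfl

instance : LieModule ℂ (AffineVirasoro θ) (LoopModule a b V) where
  smul_lie r x w := by simp [lie_def]
  lie_smul r x w := by simp [lie_def]

/-! The defining formulas of the loop module. -/

theorem vir_mon (m n : ℤ) (v : V) :
    ⁅vir θ m, mon a b n v⁆ = (a + b * m + n) • mon a b (m + n) v := by
  simp [lie_def, vir, act_hom]

theorem cur_mon (m n : ℤ) (x : g) (v : V) :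
    ⁅cur θ m x, mon a b n v⁆ = mon a b (m + n) ⁅x, v⁆ := by
  simp [lie_def, cur, act_hom]

theorem K_lie (w : LoopModule a b V) : ⁅K θ, w⁆ = 0 := by simp [lie_def, act_K]

theorem C_lie (w : LoopModule a b V) : ⁅C θ, w⁆ = 0 := by simp [lie_def, act_C]

end LoopModule

/-! ### The shifted module -/

/-- The space `W ⊗ V ⊗ ℂ[t, t⁻¹]` underlying the shifted module with parameters `l, a, b`;
`w ⊗ v ⊗ tⁿ` is `Finsupp.single n (w ⊗ₜ v)`. -/
def ShiftedModule (_l _a _b : ℂ) (W : Type w) (V : Type v) [AddCommGroup W] [Module ℂ W]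
    [AddCommGroup V] [Module ℂ V] : Type (max w v) := ℤ →₀ W ⊗[ℂ] V

namespace ShiftedModule

variable (l a b : ℂ) (W : Type w) (V : Type v) [AddCommGroup W] [Module ℂ W]
    [AddCommGroup V] [Module ℂ V]

instance : AddCommGroup (ShiftedModule l a b W V) := inferInstanceAs (AddCommGroup (ℤ →₀ W ⊗[ℂ] V))

instance : Module ℂ (ShiftedModule l a b W V) := inferInstanceAs (Module ℂ (ℤ →₀ W ⊗[ℂ] V))

variable {W V} in
/-- The element `z ⊗ tⁿ` for `z` in `W ⊗ V`. -/
def mon (n : ℤ) : W ⊗[ℂ] V →ₗ[ℂ] ShiftedModule l a b W V := Finsupp.lsingle n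

variable (θ : H.root) [LieRingModule g V] [LieModule ℂ g V]
  [LieRingModule (AffineVirasoro θ) W] [LieModule ℂ (AffineVirasoro θ) W]

theorem mon_ext {N : Type*} [AddCommGroup N] [Module ℂ N]
    {f f' : ShiftedModule l a b W V →ₗ[ℂ] N}
    (h : ∀ n w v, f (mon l a b n (w ⊗ₜ v)) = f' (mon l a b n (w ⊗ₜ v))) : f = f' := by
  apply Finsupp.lhom_ext'
  intro n
  apply TensorProduct.ext'
  intro w v
  exact h n w v

variable {W V} in
/-- The linear map on the shifted module with given values on the elements `z ⊗ tⁿ`. -/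
def lift {N : Type*} [AddCommGroup N] [Module ℂ N] (f : ℤ → W ⊗[ℂ] V →ₗ[ℂ] N) :
    ShiftedModule l a b W V →ₗ[ℂ] N :=
  Finsupp.lsum ℂ f

variable {W V} in
theorem lift_mon {N : Type*} [AddCommGroup N] [Module ℂ N] (f : ℤ → W ⊗[ℂ] V →ₗ[ℂ] N) (n : ℤ)
    (z : W ⊗[ℂ] V) : lift l a b f (mon l a b n z) = f n z :=
  Finsupp.lsum_single ℂ f n z

/-- The action of `x(m) + s dₘ`: it maps `w ⊗ v ⊗ tⁿ` to
`((x(m) w) ⊗ v + w ⊗ (x v) + s (dₘ + a + n - (d₀ - l) + b m) w ⊗ v) ⊗ t^(m+n)`.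
If `w` has degree `p`, that is `d₀ w = (l + p) w`, then `(d₀ - l) w = p w`. -/
def homAct (m : ℤ) : (g × ℂ) →ₗ[ℂ] End ℂ (ShiftedModule l a b W V) where
  toFun X := lift l a b fun n : ℤ => mon l a b (m + n) ∘ₗ
    ((LieModule.toEnd ℂ (AffineVirasoro θ) W (hom θ m X)
        + X.2 • ((a + n + b * m) • LinearMap.id
          - (LieModule.toEnd ℂ (AffineVirasoro θ) W (vir θ 0) - l • LinearMap.id))).rTensor V
      + (LieModule.toEnd ℂ g V X.1).lTensor W)
  map_add' X Y := by
    apply mon_ext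
    intro n w v
    rw [LinearMap.add_apply]
    simp only [lift_mon, LinearMap.comp_apply, LinearMap.add_apply, ← map_add (mon l a b _)]
    congr 1
    simp only [map_add, LinearMap.rTensor_tmul, LinearMap.lTensor_tmul, LinearMap.add_apply,
      Prod.fst_add, Prod.snd_add, add_smul, TensorProduct.add_tmul, TensorProduct.tmul_add]
    abel
  map_smul' r X := by
    apply mon_ext
    intro n w v
    rw [LinearMap.smul_apply]
    simp only [lift_mon, LinearMap.comp_apply, ← map_smul (mon l a b _)]
    congr 1
    simp only [map_smul, LinearMap.rTensor_tmul, LinearMap.lTensor_tmul, LinearMap.add_apply,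
      Prod.smul_fst, Prod.smul_snd, LinearMap.smul_apply, TensorProduct.add_tmul, smul_add,
      TensorProduct.smul_tmul', TensorProduct.tmul_smul, smul_assoc, RingHom.id_apply]

/-- The action of the affine-Virasoro algebra; `𝐤` and `𝐜` act through `W`. -/
def act : AffineVirasoro θ →ₗ[ℂ] End ℂ (ShiftedModule l a b W V) :=
  AffineVirasoro.lift θ (homAct l a b W V θ)
    (lift l a b fun n : ℤ => mon l a b n ∘ₗ
        (LieModule.toEnd ℂ (AffineVirasoro θ) W (K θ)).rTensor V)
    (lift l a b fun n : ℤ => mon l a b n ∘ₗ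
        (LieModule.toEnd ℂ (AffineVirasoro θ) W (C θ)).rTensor V)

theorem act_hom (m n : ℤ) (X : g × ℂ) (w : W) (v : V) :
    act l a b W V θ (hom θ m X) (mon l a b n (w ⊗ₜ v)) =
      mon l a b (m + n) ((⁅hom θ m X, w⁆ + X.2 • ((a + n + b * m) • w
        - (⁅vir θ 0, w⁆ - l • w))) ⊗ₜ v + w ⊗ₜ ⁅X.1, v⁆) := by
  rw [act, lift_hom]
  exact lift_mon l a b _ n _

theorem act_K (n : ℤ) (w : W) (v : V) :
    act l a b W V θ (K θ) (mon l a b n (w ⊗ₜ v)) = mon l a b n (⁅K θ, w⁆ ⊗ₜ v) := by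
  rw [act, lift_K]
  exact lift_mon l a b _ n _

theorem act_C (n : ℤ) (w : W) (v : V) :
    act l a b W V θ (C θ) (mon l a b n (w ⊗ₜ v)) = mon l a b n (⁅C θ, w⁆ ⊗ₜ v) := by
  rw [act, lift_C]
  exact lift_mon l a b _ n _

theorem lie_d_hom (m : ℤ) (X : g × ℂ) (w : W) :
    ⁅vir θ 0, ⁅hom θ m X, w⁆⁆ = (m : ℂ) • ⁅hom θ m X, w⁆ + ⁅hom θ m X, ⁅vir θ 0, w⁆⁆ := by
  have h : ⁅vir θ 0, hom θ m X⁆ = (m : ℂ) • hom θ m X := by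
    have e : (⁅(0 : g), X.1⁆ + ((m : ℂ) * 1) • X.1 - (((0 : ℤ) : ℂ) * X.2) • (0 : g),
          ((m : ℂ) - (0 : ℤ)) * (1 * X.2)) = (m : ℂ) • X := by
      ext <;> simp
    rw [vir, AffineVirasoro.lie_def, bracketₗ_hom, homBracket_apply, e]
    simp
  rw [leibniz_lie, h, smul_lie]

theorem act_lie_hom (m n p : ℤ) (X Y : g × ℂ) (w : W) (v : V) :
    act l a b W V θ ⁅hom θ m X, hom θ n Y⁆ (mon l a b p (w ⊗ₜ v)) =
      act l a b W V θ (hom θ m X) (act l a b W V θ (hom θ n Y) (mon l a b p (w ⊗ₜ v))) -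
      act l a b W V θ (hom θ n Y) (act l a b W V θ (hom θ m X) (mon l a b p (w ⊗ₜ v))) := by
  have hw : ⁅hom θ m X, ⁅hom θ n Y, w⁆⁆ =
      ⁅⁅hom θ m X, hom θ n Y⁆, w⁆ + ⁅hom θ n Y, ⁅hom θ m X, w⁆⁆ := leibniz_lie _ _ _
  have hk : ∀ (t : ℂ) (z : W ⊗[ℂ] V), (if m + n = 0 then t else 0) • mon l a b p z =
      mon l a b (m + n + p) ((if m + n = 0 then t else 0) • z) := by
    intro t z
    split_ifs with h
    · rw [h, zero_add, map_smul]
    · simp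
  rw [AffineVirasoro.lie_def, bracketₗ_hom, homBracket_apply] at hw ⊢
  generalize (m : ℂ) * normalizedForm θ X.1 Y.1 = t at *
  generalize ((m : ℂ) ^ 3 - m) / 12 * (X.2 * Y.2) = t' at *
  simp only [map_add (act l a b W V θ), map_smul (act l a b W V θ), LinearMap.add_apply,
    LinearMap.smul_apply, act_K, act_C, hk]
  simp only [act_hom, map_add (mon l a b _), map_add (act l a b W V θ _)]
  simp only [← map_add (mon l a b _), ← add_assoc, add_comm n m]
  rw [← map_sub]
  congr 1
  simp only [add_lie, smul_lie] at hw
  simp only [lie_add, lie_sub, lie_smul, lie_d_hom, hw, sub_lie, add_lie, smul_lie,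
    leibniz_lie X.1 Y.1 v, TensorProduct.add_tmul, TensorProduct.tmul_add, TensorProduct.sub_tmul,
    TensorProduct.tmul_sub, ← TensorProduct.smul_tmul', TensorProduct.tmul_smul]
  push_cast
  module

theorem act_K_hom (n p : ℤ) (X : g × ℂ) (w : W) (v : V) :
    act l a b W V θ (K θ) (act l a b W V θ (hom θ n X) (mon l a b p (w ⊗ₜ v))) =
      act l a b W V θ (hom θ n X) (act l a b W V θ (K θ) (mon l a b p (w ⊗ₜ v))) := by
  have h : ∀ (y : AffineVirasoro θ) (w : W), ⁅K θ, ⁅y, w⁆⁆ = ⁅y, ⁅K θ, w⁆⁆ := by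
    intro y w
    have h0 : ⁅K θ, y⁆ = 0 := bracketₗ_K θ y
    rw [leibniz_lie, h0, zero_lie, zero_add]
  rw [act_hom, act_K, act_hom, map_add (mon l a b _), map_add (act l a b W V θ _), act_K, act_K,
    ← map_add (mon l a b _)]
  simp only [lie_add, lie_sub, lie_smul, h]

theorem act_C_hom (n p : ℤ) (X : g × ℂ) (w : W) (v : V) :
    act l a b W V θ (C θ) (act l a b W V θ (hom θ n X) (mon l a b p (w ⊗ₜ v))) =
      act l a b W V θ (hom θ n X) (act l a b W V θ (C θ) (mon l a b p (w ⊗ₜ v))) := by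
  have h : ∀ (y : AffineVirasoro θ) (w : W), ⁅C θ, ⁅y, w⁆⁆ = ⁅y, ⁅C θ, w⁆⁆ := by
    intro y w
    have h0 : ⁅C θ, y⁆ = 0 := bracketₗ_C θ y
    rw [leibniz_lie, h0, zero_lie, zero_add]
  rw [act_hom, act_C, act_hom, map_add (mon l a b _), map_add (act l a b W V θ _), act_C, act_C,
    ← map_add (mon l a b _)]
  simp only [lie_add, lie_sub, lie_smul, h]

theorem act_lie (x y : AffineVirasoro θ) :
    act l a b W V θ ⁅x, y⁆ =
      act l a b W V θ x * act l a b W V θ y - act l a b W V θ y * act l a b W V θ x := by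
  apply rep_lie
  · exact fun m n X Y => mon_ext _ _ _ _ _ fun p w v => act_lie_hom l a b W V θ m n p X Y w v
  · exact fun n X => mon_ext _ _ _ _ _ fun p w v => act_K_hom l a b W V θ n p X w v
  · exact fun n X => mon_ext _ _ _ _ _ fun p w v => act_C_hom l a b W V θ n p X w v
  · apply mon_ext
    intro p w v
    have h0 : ⁅K θ, C θ⁆ = 0 := bracketₗ_K θ (C θ)
    have h : ⁅K θ, ⁅C θ, w⁆⁆ = ⁅C θ, ⁅K θ, w⁆⁆ := by rw [leibniz_lie, h0, zero_lie, zero_add]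
    rw [Module.End.mul_apply, Module.End.mul_apply, act_C, act_K, act_K, act_C, h]

instance : LieRingModule (AffineVirasoro θ) (ShiftedModule l a b W V) where
  bracket x z := act l a b W V θ x z
  add_lie x y z := by simp
  lie_add x z z' := by simp
  leibniz_lie x y z := by rw [act_lie]; simp

theorem lie_def (x : AffineVirasoro θ) (z : ShiftedModule l a b W V) :
    ⁅x, z⁆ = act l a b W V θ x z := rfl

instance : LieModule ℂ (AffineVirasoro θ) (ShiftedModule l a b W V) where
  smul_lie r x z := by simp [lie_def]
  lie_smul r x z := by simp [lie_def]

/-! The defining formulas of the shifted module. -/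

/-- If `w` is homogeneous of degree `p`, that is `d₀ w = (l + p) w`, then
`dₘ (w ⊗ v ⊗ tⁿ) = (dₘ + a + n - p + b m) w ⊗ v ⊗ t^(m+n)`. -/
theorem vir_mon (m n p : ℤ) (w : W) (hw : ⁅vir θ 0, w⁆ = (l + p) • w) (v : V) :
    ⁅vir θ m, mon l a b n (w ⊗ₜ v)⁆ =
      mon l a b (m + n) ((⁅vir θ m, w⁆ + (a + n - p + b * m) • w) ⊗ₜ v) := by
  have h := act_hom l a b W V θ m n (0, 1) w v
  rw [hw, zero_lie, TensorProduct.tmul_zero, add_zero] at h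
  refine h.trans ?_
  congr 2
  change ⁅vir θ m, w⁆ + _ = _
  module

theorem cur_mon (m n : ℤ) (x : g) (w : W) (v : V) :
    ⁅cur θ m x, mon l a b n (w ⊗ₜ v)⁆ =
      mon l a b (m + n) (⁅cur θ m x, w⁆ ⊗ₜ v + w ⊗ₜ ⁅x, v⁆) := by
  rw [lie_def, cur, act_hom, zero_smul, add_zero]

theorem K_mon (n : ℤ) (k : ℂ) (w : W) (hw : ⁅K θ, w⁆ = k • w) (v : V) :
    ⁅K θ, mon l a b n (w ⊗ₜ v)⁆ = k • mon l a b n (w ⊗ₜ v) := by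
  rw [lie_def, act_K, hw, ← TensorProduct.smul_tmul', map_smul]

theorem C_mon (n : ℤ) (c : ℂ) (w : W) (hw : ⁅C θ, w⁆ = c • w) (v : V) :
    ⁅C θ, mon l a b n (w ⊗ₜ v)⁆ = c • mon l a b n (w ⊗ₜ v) := by
  rw [lie_def, act_C, hw, ← TensorProduct.smul_tmul', map_smul]

end ShiftedModule

end Simple

/-! ### Endomorphism algebras and indecomposability -/

/-- The algebra of endomorphisms of the module `M` over the complex Lie algebra `L`: the linear
endomorphisms that commute with the action of `L`. -/
def LieEnd (L : Type u) (M : Type v) [LieRing L] [LieAlgebra ℂ L] [AddCommGroup M] [Module ℂ M]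
    [LieRingModule L M] [LieModule ℂ L M] : Subalgebra ℂ (End ℂ M) :=
  Subalgebra.centralizer ℂ (Set.range (LieModule.toEnd ℂ L M))

/-- `M` is an indecomposable module over the complex Lie algebra `L`: it is nonzero and not the direct
sum of two nonzero submodules. -/
def IsIndecomposable (L : Type u) (M : Type v) [LieRing L] [AddCommGroup M] [Module ℂ M]
    [LieRingModule L M] : Prop :=
  Nontrivial M ∧ ∀ N N' : LieSubmodule ℂ L M, IsCompl N N' → N = ⊥ ∨ N' = ⊥

end

/-!
Let `W` be the irreducible quotient `L(λ, l, k, c)`. Everything rests on two properties of `W`: it is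
irreducible, and it is generated by a vector `u` that all elements of positive degree annihilate
(`IsVacuumVector`). Hence `W` is the direct sum of its subspaces of integral degree, and it is
restricted: every vector is killed by all `x(m)` and `dₘ` with `m` large. The grading makes
`w ⊗ (v ⊗ tⁿ) ↦ w ⊗ v ⊗ t^(n + deg w)` a well-defined isomorphism of modules
(`exists_loop_equiv_shifted`). The advantage of the shifted module is that `d₀` acts on
`W ⊗ V ⊗ tⁿ` by the scalar `l + a + n`, so that an endomorphism `φ` preserves these subspaces.

The endomorphisms are determined as follows (`ShiftedModule.forall_scalar`). For `m` large, `x(m)`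
acts on both `u ⊗ v ⊗ tⁿ` and `φ(u ⊗ v ⊗ tⁿ)` through the factor `V` only. Hence
`φ(u ⊗ x v ⊗ t^N)`, for `N` large, equals `x φ(u ⊗ v ⊗ tⁿ)` up to the power of `t`, whatever `n`
is. As `V` has no invariants, which is where `μ ≠ 0` enters, `φ(u ⊗ v ⊗ tⁿ)` is independent of `n`
up to the power of `t`; it depends on `v` in a `g`-equivariant way, so that by Schur's lemma
`φ(u ⊗ v ⊗ tⁿ) = u' ⊗ v ⊗ tⁿ` for some `u'` in `W` (`ShiftedModule.exists_relates_vacuum`). The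
vectors `w` for which `φ(w ⊗ v ⊗ tⁿ) = w' ⊗ v ⊗ tⁿ` with some `w'` independent of `v` and `n` form a
submodule of `W`, which is all of `W`, and `w ↦ w'` is an endomorphism of `W`. It is a scalar by the
countable-dimensional form of Schur's lemma (`forall_scalar_of_isIrreducible`), hence so is `φ`.

A module all of whose endomorphisms are scalars is indecomposable, as a decomposition gives an
idempotent endomorphism (`isIndecomposable_of_forall_scalar`).
-/

noncomputable section

set_option linter.unusedSectionVars false

open AffineVirasoro Filter

/-! ### Endomorphisms of modules over a complex Lie algebra -/

section Endomorphisms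

variable {L : Type u} {M : Type v} {N : Type w} [LieRing L] [LieAlgebra ℂ L]
  [AddCommGroup M] [Module ℂ M] [LieRingModule L M] [LieModule ℂ L M]
  [AddCommGroup N] [Module ℂ N] [LieRingModule L N] [LieModule ℂ L N]

theorem mem_lieEnd {f : End ℂ M} : f ∈ LieEnd L M ↔ ∀ (x : L) (m : M), f ⁅x, m⁆ = ⁅x, f m⁆ := by
  simp only [LieEnd, Subalgebra.mem_centralizer_iff, Set.forall_mem_range]
  refine forall_congr' fun x => ?_
  rw [LinearMap.ext_iff]
  exact forall_congr' fun m => eq_comm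

theorem lieEnd_equiv_of_forall_scalar [Nontrivial M]
    (h : ∀ f ∈ LieEnd L M, ∃ c : ℂ, ∀ m, f m = c • m) : Nonempty (LieEnd L M ≃ₐ[ℂ] ℂ) := by
  refine ⟨(AlgEquiv.ofBijective (Algebra.ofId ℂ (LieEnd L M)) ⟨?_, ?_⟩).symm⟩
  · exact (algebraMap ℂ (LieEnd L M)).injective
  · rintro ⟨f, hf⟩
    obtain ⟨c, hc⟩ := h f hf
    refine ⟨c, Subtype.ext (LinearMap.ext fun m => ?_)⟩
    exact (hc m).symm

/-- A decomposition into two submodules gives a projection in the endomorphism algebra; being an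
idempotent scalar, it is `0` or `1`. -/
theorem isIndecomposable_of_forall_scalar [Nontrivial M]
    (h : ∀ f ∈ LieEnd L M, ∃ c : ℂ, ∀ m, f m = c • m) : IsIndecomposable L M := by
  refine ⟨inferInstance, fun P Q hPQ => ?_⟩
  have hc : IsCompl (P : Submodule ℂ M) (Q : Submodule ℂ M) :=
    LieSubmodule.isCompl_toSubmodule.mpr hPQ
  let π : End ℂ M := (P : Submodule ℂ M).projection Q hc
  have hP : ∀ m ∈ P, π m = m := fun m hm =>
    Submodule.projection_apply_of_mem_left hc hm
  have hQ : ∀ m ∈ Q, π m = 0 := fun m hm =>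
    Submodule.projection_apply_of_mem_right hc hm
  have hmem : π ∈ LieEnd L M := by
    rw [mem_lieEnd]
    intro x m
    obtain ⟨p, hp, q, hq, rfl⟩ : ∃ p ∈ P, ∃ q ∈ Q, p + q = m := by
      have : m ∈ (P : Submodule ℂ M) ⊔ (Q : Submodule ℂ M) := by
        rw [hc.sup_eq_top]; trivial
      exact Submodule.mem_sup.mp this
    rw [lie_add, map_add, map_add, hP _ hp, hQ _ hq, hP _ (P.lie_mem hp), hQ _ (Q.lie_mem hq)]
    simp
  obtain ⟨c, hcm⟩ := h _ hmem
  by_cases h0 : c = 0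
  · left
    rw [LieSubmodule.eq_bot_iff]
    intro m hm
    rw [← hP m hm, hcm, h0, zero_smul]
  · right
    rw [LieSubmodule.eq_bot_iff]
    intro m hm
    have := hcm m
    rw [hQ m hm] at this
    exact (smul_eq_zero.mp this.symm).resolve_left h0

theorem forall_scalar_of_equiv (e : M ≃ₗ⁅ℂ, L⁆ N)
    (h : ∀ f ∈ LieEnd L N, ∃ c : ℂ, ∀ m, f m = c • m) :
    ∀ f ∈ LieEnd L M, ∃ c : ℂ, ∀ m, f m = c • m := by
  intro f hf
  rw [mem_lieEnd] at hf
  obtain ⟨c, hc⟩ := h ((e : M →ₗ[ℂ] N) ∘ₗ f ∘ₗ (e.symm : N →ₗ[ℂ] M)) (by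
    rw [mem_lieEnd]
    intro x n
    change e (f (e.symm ⁅x, n⁆)) = ⁅x, e (f (e.symm n))⁆
    rw [← LieModuleEquiv.coe_toLieModuleHom e, ← LieModuleEquiv.coe_toLieModuleHom e.symm,
      LieModuleHom.map_lie, hf, LieModuleHom.map_lie])
  refine ⟨c, fun m => ?_⟩
  have h1 : e (f (e.symm (e m))) = c • e m := hc (e m)
  rw [LieModuleEquiv.symm_apply_apply] at h1
  apply e.injective
  rw [h1]
  exact (map_smul (e : M →ₗ[ℂ] N) c m).symm

/-- If `f - c` is bijective for all `c`, then the vectors `(f - c)⁻¹ u` are linearly independent,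
because a linear relation between them is of the form `p(f) u = 0` for a polynomial `p ≠ 0`, and
`p` splits. As `ℂ` is uncountable, this is impossible in a space of countable dimension. -/
theorem exists_not_bijective_sub [Nontrivial M] (hM : Module.rank ℂ M ≤ Cardinal.aleph0)
    (f : End ℂ M) : ∃ c : ℂ, ¬ Function.Bijective (f - algebraMap ℂ (End ℂ M) c) := by
  classical
  by_contra! hf
  obtain ⟨u, hu⟩ := exists_ne (0 : M)
  choose v hv using fun c => (hf c).2 u
  have hinj : ∀ p : Polynomial ℂ, p ≠ 0 → Function.Injective (Polynomial.aeval f p) := by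
    intro p
    induction hd : p.natDegree generalizing p with
    | zero =>
      intro hp
      obtain ⟨a, rfl⟩ := Polynomial.natDegree_eq_zero.mp hd
      have ha : a ≠ 0 := by rintro rfl; simp at hp
      rw [Polynomial.aeval_C]
      exact smul_right_injective M ha
    | succ d ih =>
      intro hp
      obtain ⟨z, hz⟩ := IsAlgClosed.exists_root p (by
        rw [Polynomial.degree_eq_natDegree hp, hd]; exact_mod_cast d.succ_ne_zero)
      obtain ⟨q, rfl⟩ := Polynomial.dvd_iff_isRoot.mpr hz
      have hq : q ≠ 0 := right_ne_zero_of_mul hp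
      rw [Polynomial.natDegree_mul (Polynomial.X_sub_C_ne_zero z) hq,
        Polynomial.natDegree_X_sub_C] at hd
      rw [map_mul, map_sub, Polynomial.aeval_X, Polynomial.aeval_C]
      exact (hf z).1.comp (ih q (by omega) hq)
  have hli : LinearIndependent ℂ v := by
    rw [linearIndependent_iff']
    intro s a hs i hi
    let r : ℂ → Polynomial ℂ := fun i => ∏ j ∈ s.erase i, (Polynomial.X - Polynomial.C j)
    have hr : ∀ i ∈ s, Polynomial.aeval f (∏ j ∈ s, (Polynomial.X - Polynomial.C j)) (v i) =
        Polynomial.aeval f (r i) u := by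
      intro i hi
      rw [← Finset.prod_erase_mul s _ hi, map_mul, Module.End.mul_apply, map_sub,
        Polynomial.aeval_X, Polynomial.aeval_C, hv]
    have h1 : Polynomial.aeval f (∑ i ∈ s, a i • r i) u = 0 := by
      rw [← map_zero (Polynomial.aeval f (∏ j ∈ s, (Polynomial.X - Polynomial.C j))), ← hs,
        map_sum, map_sum, LinearMap.sum_apply]
      refine Finset.sum_congr rfl fun i hi => ?_
      rw [map_smul, map_smul, LinearMap.smul_apply, hr i hi]
    have h2 : ∑ i ∈ s, a i • r i = 0 := by
      by_contra h
      exact hu (hinj _ h (h1.trans (map_zero _).symm))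
    have h3 := congrArg (Polynomial.eval i) h2
    rw [Polynomial.eval_finsetSum, Finset.sum_eq_single i] at h3
    · simp only [r, Polynomial.eval_smul, Polynomial.eval_prod, Polynomial.eval_sub,
        Polynomial.eval_X, Polynomial.eval_C, Polynomial.eval_zero, smul_eq_mul] at h3
      refine (mul_eq_zero.mp h3).resolve_right (Finset.prod_ne_zero_iff.mpr fun j hj => ?_)
      exact sub_ne_zero.mpr (Finset.ne_of_mem_erase hj).symm
    · intro j hj hji
      have : i ∈ s.erase j := Finset.mem_erase.mpr ⟨hji.symm, hi⟩
      rw [Polynomial.eval_smul, Polynomial.eval_prod, Finset.prod_eq_zero this (by simp),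
        smul_zero]
    · intro h; exact absurd hi h
  have h4 := hli.cardinal_lift_le_rank
  rw [Cardinal.mk_complex, Cardinal.lift_continuum] at h4
  have h5 := h4.trans (Cardinal.lift_le.mpr hM)
  rw [Cardinal.lift_aleph0] at h5
  exact absurd h5 (not_le.mpr Cardinal.aleph0_lt_continuum)

/-- Schur's lemma for modules of countable dimension, in the form given by Dixmier. -/
theorem forall_scalar_of_isIrreducible [LieModule.IsIrreducible ℂ L M]
    (hM : Module.rank ℂ M ≤ Cardinal.aleph0) :
    ∀ f ∈ LieEnd L M, ∃ c : ℂ, ∀ m, f m = c • m := by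
  intro f hf
  rw [mem_lieEnd] at hf
  have : Nontrivial M := LieModule.nontrivial_of_isIrreducible ℂ L M
  obtain ⟨c, hc⟩ := exists_not_bijective_sub hM f
  let F : M →ₗ⁅ℂ, L⁆ M :=
    { f - algebraMap ℂ (End ℂ M) c with
      map_lie' := by
        intro x m
        change f ⁅x, m⁆ - c • ⁅x, m⁆ = ⁅x, f m - c • m⁆
        rw [hf, lie_sub, lie_smul] }
  have hF : ∀ m, F m = f m - c • m := fun _ => rfl
  refine ⟨c, fun m => ?_⟩
  rcases eq_bot_or_eq_top F.ker with hk | hk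
  · rcases eq_bot_or_eq_top F.range with hr | hr
    · have : F m ∈ F.range := (LieModuleHom.mem_range F _).mpr ⟨m, rfl⟩
      rw [hr, LieSubmodule.mem_bot] at this
      rw [← sub_eq_zero, ← hF, this]
    · exact absurd ⟨(LieModuleHom.ker_eq_bot F).mp hk, (LieModuleHom.range_eq_top F).mp hr⟩ hc
  · have : m ∈ F.ker := by rw [hk]; trivial
    rw [LieModuleHom.mem_ker, hF] at this
    exact sub_eq_zero.mp this

/-- A nonzero vector generates an irreducible module, which is thus spanned by the countable set of
iterated images of this vector under a countable spanning set of the Lie algebra. -/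
theorem rank_le_aleph0_of_isIrreducible [LieModule.IsIrreducible ℂ L M]
    {S : Set L} (hS : S.Countable) (hspan : Submodule.span ℂ S = ⊤) :
    Module.rank ℂ M ≤ Cardinal.aleph0 := by
  have : Nontrivial M := LieModule.nontrivial_of_isIrreducible ℂ L M
  obtain ⟨u, hu⟩ := exists_ne (0 : M)
  have : Countable S := hS
  let word : List S → M := fun s => s.foldr (fun x m => ⁅(x : L), m⁆) u
  have hword : ∀ (x : S) s, ⁅(x : L), word s⁆ = word (x :: s) := fun _ _ => rfl
  let P : LieSubmodule ℂ L M :=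
    { Submodule.span ℂ (Set.range word) with
      lie_mem := by
        intro x m hm
        change ⁅x, m⁆ ∈ Submodule.span ℂ (Set.range word)
        change m ∈ Submodule.span ℂ (Set.range word) at hm
        have hx : x ∈ Submodule.span ℂ S := by rw [hspan]; trivial
        induction hx using Submodule.span_induction with
        | zero => rw [zero_lie]; exact zero_mem _
        | add x y _ _ hx hy => rw [add_lie]; exact add_mem hx hy
        | smul r x _ hx => rw [smul_lie]; exact Submodule.smul_mem _ _ hx
        | mem x hx =>
          induction hm using Submodule.span_induction with
          | zero => rw [lie_zero]; exact zero_mem _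
          | add x y _ _ hx hy => rw [lie_add]; exact add_mem hx hy
          | smul r x _ hx => rw [lie_smul]; exact Submodule.smul_mem _ _ hx
          | mem m hm =>
            obtain ⟨s, rfl⟩ := hm
            exact Submodule.subset_span ⟨⟨x, hx⟩ :: s, rfl⟩ }
  have hP : P = ⊤ := by
    refine (eq_bot_or_eq_top P).resolve_left fun h => hu ?_
    have : u ∈ P := Submodule.subset_span (s := Set.range word) ⟨[], rfl⟩
    rwa [h, LieSubmodule.mem_bot] at this
  have htop : Submodule.span ℂ (Set.range word) = ⊤ :=
    congrArg LieSubmodule.toSubmodule hP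
  rw [← rank_top, ← htop]
  exact (rank_span_le _).trans (Set.countable_range word).le_aleph0

end Endomorphisms

/-! ### Irreducible modules of highest weight type -/

section HighestWeight

variable {g : Type u} [LieRing g] [LieAlgebra ℂ g] [FiniteDimensional ℂ g]
  [LieAlgebra.IsSimple ℂ g] {H : LieSubalgebra ℂ g} [H.IsCartanSubalgebra]

namespace AffineVirasoro

variable (θ : H.root)

theorem lie_hom_hom_of_ne {m n : ℤ} (h : m + n ≠ 0) (X Y : g × ℂ) :
    ∃ Z, ⁅hom θ m X, hom θ n Y⁆ = hom θ (m + n) Z := by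
  use (⁅X.1, Y.1⁆ + ((n : ℂ) * X.2) • Y.1 - ((m : ℂ) * Y.2) • X.1, ((n : ℂ) - m) * (X.2 * Y.2))
  rw [lie_def, bracketₗ_hom, homBracket_apply, if_neg h, if_neg h, zero_smul, zero_smul, add_zero,
    add_zero]

theorem hom_eq (n : ℤ) (X : g × ℂ) : hom θ n X = cur θ n X.1 + X.2 • vir θ n := by
  rw [cur, vir, ← map_smul, ← map_add]
  congr 1
  ext <;> simp

theorem exists_countable_span_eq_top :
    ∃ S : Set (AffineVirasoro θ), S.Countable ∧ Submodule.span ℂ S = ⊤ := by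
  let B := Module.finBasis ℂ (g × ℂ)
  refine ⟨(⋃ n : ℤ, Set.range fun i => hom θ n (B i)) ∪ {K θ, C θ}, ?_, ?_⟩
  · exact (Set.countable_iUnion fun n => Set.countable_range _).union
      ((Set.countable_singleton _).insert _)
  · rw [← Submodule.ker_mkQ (Submodule.span ℂ _), LinearMap.ker_eq_top]
    apply hom_ext
    · intro n X
      suffices (Submodule.mkQ (Submodule.span ℂ _)) ∘ₗ hom θ n = 0 from LinearMap.congr_fun this X
      refine B.ext fun i => ?_
      rw [LinearMap.comp_apply, LinearMap.zero_apply, Submodule.mkQ_apply,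
        Submodule.Quotient.mk_eq_zero]
      exact Submodule.subset_span (Or.inl (Set.mem_iUnion.mpr ⟨n, i, rfl⟩))
    · rw [LinearMap.zero_apply, Submodule.mkQ_apply, Submodule.Quotient.mk_eq_zero]
      exact Submodule.subset_span (Or.inr (Or.inl rfl))
    · rw [LinearMap.zero_apply, Submodule.mkQ_apply, Submodule.Quotient.mk_eq_zero]
      exact Submodule.subset_span (Or.inr (Or.inr rfl))

end AffineVirasoro

/-- `u` is a nonzero vector of `d₀`-weight `l` that is annihilated by all elements of positive degree
and on which `𝐤` and `𝐜` act by the scalars `k` and `c`. No condition is put on the action of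
`g(0)`. -/
structure IsVacuumVector (θ : H.root) (l k c : ℂ) {W : Type w} [AddCommGroup W] [Module ℂ W]
    [LieRingModule (AffineVirasoro θ) W] [LieModule ℂ (AffineVirasoro θ) W] (u : W) : Prop where
  ne_zero : u ≠ 0
  d_zero : ⁅vir θ 0, u⁆ = l • u
  level : ⁅K θ, u⁆ = k • u
  charge : ⁅C θ, u⁆ = c • u
  pos : ∀ n : ℤ, 0 < n → ∀ X, ⁅hom θ n X, u⁆ = 0

namespace IsVacuumVector

variable {θ : H.root} {l k c : ℂ} {W : Type w} [AddCommGroup W] [Module ℂ W]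
    [LieRingModule (AffineVirasoro θ) W] [LieModule ℂ (AffineVirasoro θ) W]
    [LieModule.IsIrreducible ℂ (AffineVirasoro θ) W] {u : W}

/-- In an irreducible module a central element acts by a scalar as soon as it has an eigenvector. -/
theorem lie_eq_smul_of_central (hu : u ≠ 0) {z : AffineVirasoro θ} 
    (hz : ∀ x : AffineVirasoro θ, ⁅x, z⁆ = 0) {r : ℂ}
    (h : ⁅z, u⁆ = r • u) (w : W) : ⁅z, w⁆ = r • w := by
  let P : LieSubmodule ℂ (AffineVirasoro θ) W :=
    { LinearMap.ker (LieModule.toEnd ℂ (AffineVirasoro θ) W z - r • LinearMap.id) with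
      lie_mem := by
        intro x m hm
        change ⁅z, m⁆ - r • m = 0 at hm
        change ⁅z, ⁅x, m⁆⁆ - r • ⁅x, m⁆ = 0
        rw [leibniz_lie, ← lie_skew, hz, neg_zero, zero_lie, zero_add, sub_eq_zero.mp hm, lie_smul,
          sub_self] }
  have hmem : ∀ m, m ∈ P ↔ ⁅z, m⁆ - r • m = 0 := fun m => Iff.rfl
  have hP : P = ⊤ := by
    refine (eq_bot_or_eq_top P).resolve_left fun hb => hu ?_
    have : u ∈ P := (hmem u).mpr (sub_eq_zero.mpr h)
    rwa [hb, LieSubmodule.mem_bot] at this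
  have : w ∈ P := by rw [hP]; trivial
  exact sub_eq_zero.mp ((hmem w).mp this)

theorem K_lie (hu : IsVacuumVector θ l k c u) (w : W) : ⁅K θ, w⁆ = k • w :=
  lie_eq_smul_of_central hu.ne_zero (lie_K θ) hu.level w

theorem C_lie (hu : IsVacuumVector θ l k c u) (w : W) : ⁅C θ, w⁆ = c • w :=
  lie_eq_smul_of_central hu.ne_zero (lie_C θ) hu.charge w

/-- A subspace that contains `u` and is stable under the homogeneous elements is everything. -/
theorem mem_of_stable (hu : IsVacuumVector θ l k c u) (P : Submodule ℂ W) (huP : u ∈ P)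
    (h : ∀ n X w, w ∈ P → ⁅hom θ n X, w⁆ ∈ P) (w : W) : w ∈ P := by
  let Q : LieSubmodule ℂ (AffineVirasoro θ) W :=
    { P with
      lie_mem := by
        intro x m hm
        change m ∈ P at hm
        change ⁅x, m⁆ ∈ P
        suffices P.mkQ ∘ₗ (LieModule.toEnd ℂ (AffineVirasoro θ) W :
            AffineVirasoro θ →ₗ[ℂ] End ℂ W).flip m = 0 from
          (Submodule.Quotient.mk_eq_zero P).mp (LinearMap.congr_fun this x)
        apply hom_ext
        · intro n X
          exact (Submodule.Quotient.mk_eq_zero P).mpr (h n X m hm)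
        · refine (Submodule.Quotient.mk_eq_zero P).mpr ?_
          change ⁅K θ, m⁆ ∈ P
          rw [hu.K_lie]
          exact P.smul_mem _ hm
        · refine (Submodule.Quotient.mk_eq_zero P).mpr ?_
          change ⁅C θ, m⁆ ∈ P
          rw [hu.C_lie]
          exact P.smul_mem _ hm }
  have hQ : Q = ⊤ := by
    refine (eq_bot_or_eq_top Q).resolve_left fun hb => hu.ne_zero ?_
    have : u ∈ Q := huP
    rwa [hb, LieSubmodule.mem_bot] at this
  have : w ∈ Q := by rw [hQ]; trivial
  exact this

/-- The module is restricted: each vector is annihilated by all elements of large degree. -/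
theorem eventually_lie_eq_zero (hu : IsVacuumVector θ l k c u) (w : W) :
    ∀ᶠ m : ℤ in atTop, ∀ X, ⁅hom θ m X, w⁆ = 0 := by
  let P : Submodule ℂ W :=
    { carrier := {w | ∀ᶠ m : ℤ in atTop, ∀ X, ⁅hom θ m X, w⁆ = 0}
      zero_mem' := by simp
      add_mem' := by
        intro w w' h h'
        filter_upwards [h, h'] with m hm hm' X
        rw [lie_add, hm, hm', add_zero]
      smul_mem' := by
        intro r w h
        filter_upwards [h] with m hm X
        rw [lie_smul, hm, smul_zero] }
  refine hu.mem_of_stable P ?_ ?_ w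
  · change ∀ᶠ m : ℤ in atTop, ∀ X, ⁅hom θ m X, u⁆ = 0
    filter_upwards [eventually_gt_atTop 0] with m hm X using hu.pos m hm X
  · intro n Y w hw
    change ∀ᶠ m : ℤ in atTop, ∀ X, ⁅hom θ m X, w⁆ = 0 at hw
    change ∀ᶠ m : ℤ in atTop, ∀ X, ⁅hom θ m X, ⁅hom θ n Y, w⁆⁆ = 0
    have hshift : Tendsto (fun m : ℤ => m + n) atTop atTop :=
      tendsto_atTop_add_const_right atTop n tendsto_id
    filter_upwards [hw, hshift.eventually hw, eventually_gt_atTop (-n)] with m hm hmn hpos X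
    obtain ⟨Z, hZ⟩ := lie_hom_hom_of_ne θ (by omega : m + n ≠ 0) X Y
    rw [leibniz_lie, hZ, hmn, hm, lie_zero, add_zero]

theorem lie_hom_degree {p : ℤ} {w : W} (hw : ⁅vir θ 0, w⁆ = (l + p) • w) (m : ℤ) (X : g × ℂ) :
    ⁅vir θ 0, ⁅hom θ m X, w⁆⁆ = (l + (m + p : ℤ)) • ⁅hom θ m X, w⁆ := by
  rw [ShiftedModule.lie_d_hom, hw, lie_smul]
  push_cast
  module

theorem iSup_eigenspace_eq_top (hu : IsVacuumVector θ l k c u) :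
    ⨆ p : ℤ, End.eigenspace (LieModule.toEnd ℂ (AffineVirasoro θ) W (vir θ 0)) (l + p) = ⊤ := by
  rw [eq_top_iff]
  rintro w -
  refine hu.mem_of_stable _ ?_ ?_ w
  · refine Submodule.mem_iSup_of_mem 0 (End.mem_eigenspace_iff.mpr ?_)
    simpa using hu.d_zero
  · intro n X w hw
    induction hw using Submodule.iSup_induction' with
    | zero => rw [lie_zero]; exact zero_mem _
    | add x y _ _ hx hy => rw [lie_add]; exact add_mem hx hy
    | mem p w hw =>
      exact Submodule.mem_iSup_of_mem (n + p)
        (End.mem_eigenspace_iff.mpr (lie_hom_degree (End.mem_eigenspace_iff.mp hw) n X))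

theorem ext_of_homogeneous (hu : IsVacuumVector θ l k c u) {N : Type*} [AddCommGroup N]
    [Module ℂ N] {f f' : W →ₗ[ℂ] N}
    (h : ∀ (p : ℤ) (w : W), ⁅vir θ 0, w⁆ = (l + p) • w → f w = f' w) : f = f' := by
  ext w
  have hw : w ∈ ⨆ p : ℤ,
      End.eigenspace (LieModule.toEnd ℂ (AffineVirasoro θ) W (vir θ 0)) (l + p) := by
    rw [hu.iSup_eigenspace_eq_top]; trivial
  induction hw using Submodule.iSup_induction' with
  | zero => rw [map_zero, map_zero]
  | add x y _ _ hx hy => rw [map_add, map_add, hx, hy]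
  | mem p w hw => exact h p w (End.mem_eigenspace_iff.mp hw)

/-- The decomposition of vectors into homogeneous components, as a linear map. -/
theorem exists_components (hu : IsVacuumVector θ l k c u) :
    ∃ S : W →ₗ[ℂ] ℤ →₀ W, ∀ (p : ℤ) (w : W), ⁅vir θ 0, w⁆ = (l + p) • w →
      S w = Finsupp.single p w := by
  classical
  let A : ℤ → Submodule ℂ W := fun p =>
    End.eigenspace (LieModule.toEnd ℂ (AffineVirasoro θ) W (vir θ 0)) (l + p)
  have hA : DirectSum.IsInternal A := by
    refine (DirectSum.isInternal_submodule_iff_iSupIndep_and_iSup_eq_top A).mpr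
      ⟨?_, hu.iSup_eigenspace_eq_top⟩
    exact (End.eigenspaces_iSupIndep _).comp fun p q hpq => by simpa using hpq
  let E := LinearEquiv.ofBijective (DirectSum.coeLinearMap A) hA
  refine ⟨DirectSum.toModule ℂ ℤ (ℤ →₀ W) (fun p => Finsupp.lsingle p ∘ₗ (A p).subtype) ∘ₗ
    E.symm.toLinearMap, fun p w hw => ?_⟩
  have hE : E (DirectSum.lof ℂ ℤ (fun p => A p) p ⟨w, End.mem_eigenspace_iff.mpr hw⟩) = w :=
    DirectSum.coeLinearMap_lof A p _
  have hE' := congrArg E.symm hE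
  rw [LinearEquiv.symm_apply_apply] at hE'
  rw [LinearMap.comp_apply, LinearEquiv.coe_coe, ← hE', DirectSum.toModule_lof]
  rfl

end IsVacuumVector

theorem AffineVirasoro.forall_scalar_of_isIrreducible {θ : H.root} (W : Type w)
    [AddCommGroup W] [Module ℂ W]
    [LieRingModule (AffineVirasoro θ) W] [LieModule ℂ (AffineVirasoro θ) W]
    [LieModule.IsIrreducible ℂ (AffineVirasoro θ) W] :
    ∀ f ∈ LieEnd (AffineVirasoro θ) W, ∃ r : ℂ, ∀ w, f w = r • w := by
  obtain ⟨S, hS, hspan⟩ := AffineVirasoro.exists_countable_span_eq_top θ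
  exact _root_.forall_scalar_of_isIrreducible (rank_le_aleph0_of_isIrreducible hS hspan)

/-! ### The isomorphism with the shifted module -/

theorem exists_loop_equiv_shifted {θ : H.root} {l k c : ℂ} (a b : ℂ) {W : Type w} [AddCommGroup W]
    [Module ℂ W] [LieRingModule (AffineVirasoro θ) W] [LieModule ℂ (AffineVirasoro θ) W]
    [LieModule.IsIrreducible ℂ (AffineVirasoro θ) W] {u : W} (hu : IsVacuumVector θ l k c u)
    (V : Type v) [AddCommGroup V] [Module ℂ V] [LieRingModule g V] [LieModule ℂ g V] :
    ∃ e : W ⊗[ℂ] LoopModule a b V ≃ₗ⁅ℂ, AffineVirasoro θ⁆ ShiftedModule l a b W V,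
      ∀ (p n : ℤ) (w : W) (v : V), ⁅vir θ 0, w⁆ = (l + p) • w →
        e (w ⊗ₜ LoopModule.mon a b n v) = ShiftedModule.mon l a b (n + p) (w ⊗ₜ v) := by
  obtain ⟨S, hS⟩ := hu.exists_components
  let F : W ⊗[ℂ] LoopModule a b V →ₗ[ℂ] ShiftedModule l a b W V :=
    TensorProduct.lift ((Finsupp.lsum ℂ fun p : ℤ => LinearMap.flip (LoopModule.lift a b fun n : ℤ =>
      LinearMap.flip ((TensorProduct.mk ℂ W V).compr₂ (ShiftedModule.mon l a b (n + p))))) ∘ₗ S)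
  let G : ShiftedModule l a b W V →ₗ[ℂ] W ⊗[ℂ] LoopModule a b V :=
    ShiftedModule.lift l a b fun n : ℤ => TensorProduct.lift ((Finsupp.lsum ℂ fun p : ℤ =>
      (TensorProduct.mk ℂ W (LoopModule a b V)).compl₂ (LoopModule.mon a b (n - p))) ∘ₗ S)
  have hF : ∀ (p n : ℤ) (w : W) (v : V), ⁅vir θ 0, w⁆ = (l + p) • w →
      F (w ⊗ₜ LoopModule.mon a b n v) = ShiftedModule.mon l a b (n + p) (w ⊗ₜ v) := by
    intro p n w v hw
    simp only [F, TensorProduct.lift.tmul, LinearMap.comp_apply, hS p w hw, Finsupp.lsum_single,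
      LinearMap.flip_apply, LoopModule.lift_mon, LinearMap.compr₂_apply, TensorProduct.mk_apply]
  have hG : ∀ (p n : ℤ) (w : W) (v : V), ⁅vir θ 0, w⁆ = (l + p) • w →
      G (ShiftedModule.mon l a b n (w ⊗ₜ v)) = w ⊗ₜ LoopModule.mon a b (n - p) v := by
    intro p n w v hw
    simp only [G, ShiftedModule.lift_mon, TensorProduct.lift.tmul, LinearMap.comp_apply, hS p w hw,
      Finsupp.lsum_single, LinearMap.compl₂_apply, TensorProduct.mk_apply]
  -- Linear maps out of the tensor product are determined by their values on the elements
  -- `w ⊗ v ⊗ tⁿ` with `w` homogeneous.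
  have hext : ∀ {N : Type (max w v)} [AddCommGroup N] [Module ℂ N]
      {f f' : W ⊗[ℂ] LoopModule a b V →ₗ[ℂ] N},
      (∀ (p n : ℤ) (w : W) (v : V), ⁅vir θ 0, w⁆ = (l + p) • w →
        f (w ⊗ₜ LoopModule.mon a b n v) = f' (w ⊗ₜ LoopModule.mon a b n v)) → f = f' := by
    intro N _ _ f f' h
    refine TensorProduct.ext (hu.ext_of_homogeneous fun p w hw => ?_)
    exact LoopModule.mon_ext a b fun n v => h p n w v hw
  have hGF : G ∘ₗ F = LinearMap.id := by
    refine hext fun p n w v hw => ?_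
    rw [LinearMap.comp_apply, hF p n w v hw, hG p _ w v hw, add_sub_cancel_right]
    rfl
  have hFG : F ∘ₗ G = LinearMap.id := by
    refine ShiftedModule.mon_ext l a b W V fun n w v => ?_
    suffices h : (F ∘ₗ G ∘ₗ ShiftedModule.mon l a b n) ∘ₗ (TensorProduct.mk ℂ W V).flip v =
        ShiftedModule.mon l a b n ∘ₗ (TensorProduct.mk ℂ W V).flip v from LinearMap.congr_fun h w
    refine hu.ext_of_homogeneous fun p w hw => ?_
    change F (G (ShiftedModule.mon l a b n (w ⊗ₜ v))) = ShiftedModule.mon l a b n (w ⊗ₜ v)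
    rw [hG p n w v hw, hF p _ w v hw, sub_add_cancel]
  have hcomm : ∀ x : AffineVirasoro θ,
      F ∘ₗ LieModule.toEnd ℂ (AffineVirasoro θ) (W ⊗[ℂ] LoopModule a b V) x =
        LieModule.toEnd ℂ (AffineVirasoro θ) (ShiftedModule l a b W V) x ∘ₗ F := by
    intro x
    refine hext fun p n w v hw => ?_
    suffices h : F ∘ₗ (LieModule.toEnd ℂ (AffineVirasoro θ) (W ⊗[ℂ] LoopModule a b V) :
          AffineVirasoro θ →ₗ[ℂ] End ℂ (W ⊗[ℂ] LoopModule a b V)).flip (w ⊗ₜ LoopModule.mon a b n v) =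
        (LieModule.toEnd ℂ (AffineVirasoro θ) (ShiftedModule l a b W V) :
          AffineVirasoro θ →ₗ[ℂ] End ℂ (ShiftedModule l a b W V)).flip
          (F (w ⊗ₜ LoopModule.mon a b n v)) from LinearMap.congr_fun h x
    apply AffineVirasoro.hom_ext
    · intro m X
      change F ⁅hom θ m X, w ⊗ₜ LoopModule.mon a b n v⁆ =
        ⁅hom θ m X, F (w ⊗ₜ LoopModule.mon a b n v)⁆
      rw [TensorProduct.LieModule.lie_tmul_right, map_add, LoopModule.lie_def, LoopModule.act_hom,
        hF (m + p) n _ v (IsVacuumVector.lie_hom_degree hw m X), hF p _ w _ hw, hF p n w v hw,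
        ShiftedModule.lie_def, ShiftedModule.act_hom, hw,
        show n + (m + p) = m + (n + p) by ring, show m + n + p = m + (n + p) by ring, ← map_add]
      congr 1
      simp only [TensorProduct.add_tmul, TensorProduct.tmul_add, TensorProduct.sub_tmul,
        ← TensorProduct.smul_tmul', TensorProduct.tmul_smul]
      push_cast
      module
    · change F ⁅K θ, w ⊗ₜ LoopModule.mon a b n v⁆ = ⁅K θ, F (w ⊗ₜ LoopModule.mon a b n v)⁆
      rw [TensorProduct.LieModule.lie_tmul_right, LoopModule.K_lie, TensorProduct.tmul_zero,
        add_zero, hu.K_lie, ← TensorProduct.smul_tmul', map_smul, hF p n w v hw,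
        ShiftedModule.K_mon _ _ _ _ _ _ _ _ _ (hu.K_lie w)]
    · change F ⁅C θ, w ⊗ₜ LoopModule.mon a b n v⁆ = ⁅C θ, F (w ⊗ₜ LoopModule.mon a b n v)⁆
      rw [TensorProduct.LieModule.lie_tmul_right, LoopModule.C_lie, TensorProduct.tmul_zero,
        add_zero, hu.C_lie, ← TensorProduct.smul_tmul', map_smul, hF p n w v hw,
        ShiftedModule.C_mon _ _ _ _ _ _ _ _ _ (hu.C_lie w)]
  let e : W ⊗[ℂ] LoopModule a b V ≃ₗ⁅ℂ, AffineVirasoro θ⁆ ShiftedModule l a b W V :=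
    { F with
      map_lie' := by
        intro x z
        exact LinearMap.congr_fun (hcomm x) z
      invFun := G
      left_inv := fun z => LinearMap.congr_fun hGF z
      right_inv := fun z => LinearMap.congr_fun hFG z }
  exact ⟨e, hF⟩

end HighestWeight

/-! ### Equivariant maps into a tensor product with a multiplicity space -/

section Multiplicity

variable {g : Type u} [LieRing g] [LieAlgebra ℂ g] {W : Type w} [AddCommGroup W] [Module ℂ W]
  {V : Type v} [AddCommGroup V] [Module ℂ V]

/-- The contraction `w ⊗ v ↦ ψ(w) v`. -/
def contractFst (ψ : Dual ℂ W) : W ⊗[ℂ] V →ₗ[ℂ] V := (TensorProduct.lid ℂ V) ∘ₗ ψ.rTensor V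

/-- The contraction `w ⊗ v ↦ ξ(v) w`. -/
def contractSnd (ξ : Dual ℂ V) : W ⊗[ℂ] V →ₗ[ℂ] W := (TensorProduct.rid ℂ W) ∘ₗ ξ.lTensor W

theorem contractFst_tmul (ψ : Dual ℂ W) (w : W) (v : V) :
    contractFst ψ (w ⊗ₜ[ℂ] v) = ψ w • v := by
  simp [contractFst]

theorem contractSnd_tmul (ξ : Dual ℂ V) (w : W) (v : V) :
    contractSnd ξ (w ⊗ₜ[ℂ] v) = ξ v • w := by
  simp [contractSnd]

theorem apply_contractSnd (ψ : Dual ℂ W) (ξ : Dual ℂ V) (z : W ⊗[ℂ] V) :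
    ψ (contractSnd ξ z) = ξ (contractFst ψ z) := by
  induction z with
  | zero => simp
  | add x y hx hy => simp only [map_add, hx, hy]
  | tmul w v => rw [contractFst_tmul, contractSnd_tmul, map_smul, map_smul, smul_eq_mul,
      smul_eq_mul, mul_comm]

theorem contractFst_lTensor (ψ : Dual ℂ W) (f : End ℂ V) (z : W ⊗[ℂ] V) :
    contractFst ψ (f.lTensor W z) = f (contractFst ψ z) := by
  induction z with
  | zero => simp
  | add x y hx hy => simp only [map_add, hx, hy]
  | tmul w v => rw [LinearMap.lTensor_tmul, contractFst_tmul, contractFst_tmul, map_smul]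

theorem ext_contractFst {z z' : W ⊗[ℂ] V}
    (h : ∀ ψ : Dual ℂ W, contractFst ψ z = contractFst ψ z') : z = z' := by
  classical
  let B := Basis.ofVectorSpace ℂ W
  have key : ∀ i (z : W ⊗[ℂ] V),
      TensorProduct.equivFinsuppOfBasisLeft B z i = contractFst (B.coord i) z := by
    intro i z
    induction z with
    | zero => simp
    | add x y hx hy => simp only [map_add, Finsupp.add_apply, hx, hy]
    | tmul w v =>
      rw [contractFst_tmul, TensorProduct.equivFinsuppOfBasisLeft_apply_tmul_apply]
      rfl
  apply (TensorProduct.equivFinsuppOfBasisLeft B).injective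
  ext i
  rw [key, key, h]

variable [LieRingModule g V] [LieModule ℂ g V]

theorem eq_of_forall_lTensor_eq (hV : ∀ v : V, (∀ x : g, ⁅x, v⁆ = 0) → v = 0) {z z' : W ⊗[ℂ] V}
    (h : ∀ x : g, (LieModule.toEnd ℂ g V x).lTensor W z = (LieModule.toEnd ℂ g V x).lTensor W z') :
    z = z' := by
  refine ext_contractFst fun ψ => ?_
  rw [← sub_eq_zero]
  refine hV _ fun x => ?_
  have := congrArg (contractFst ψ) (h x)
  rw [contractFst_lTensor, contractFst_lTensor, LieModule.toEnd_apply_apply,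
    LieModule.toEnd_apply_apply] at this
  rw [lie_sub, this, sub_self]

/-- By Schur's lemma, an equivariant map from `V` to a direct sum of copies of `V` is `v ↦ w ⊗ v`. -/
theorem exists_eq_tmul [FiniteDimensional ℂ V] [LieModule.IsIrreducible ℂ g V]
    (T : V →ₗ[ℂ] W ⊗[ℂ] V)
    (hT : ∀ (x : g) v, T ⁅x, v⁆ = (LieModule.toEnd ℂ g V x).lTensor W (T v)) :
    ∃ w : W, ∀ v, T v = w ⊗ₜ v := by
  have : Nontrivial V := LieModule.nontrivial_of_isIrreducible ℂ g V
  obtain ⟨v₁, hv₁⟩ := exists_ne (0 : V)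
  obtain ⟨ξ, hξ⟩ := Module.Projective.exists_dual_eq_one ℂ hv₁
  have hrank : Module.rank ℂ V ≤ Cardinal.aleph0 := (Module.rank_lt_aleph0 ℂ V).le
  refine ⟨contractSnd ξ (T v₁), fun v => ext_contractFst fun ψ => ?_⟩
  obtain ⟨r, hr⟩ := forall_scalar_of_isIrreducible (L := g) hrank (contractFst ψ ∘ₗ T) (by
    rw [mem_lieEnd]
    intro x v
    rw [LinearMap.comp_apply, hT, contractFst_lTensor]
    rfl)
  simp only [LinearMap.comp_apply] at hr
  rw [contractFst_tmul, apply_contractSnd, hr, hr, map_smul, hξ, smul_eq_mul, mul_one]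

theorem eq_zero_of_forall_lie_eq_zero [LieModule.IsIrreducible ℂ g V] {y : g} {v₀ : V}
    (h₀ : ⁅y, v₀⁆ ≠ 0) (v : V) (hv : ∀ x : g, ⁅x, v⁆ = 0) : v = 0 := by
  have hmem : v ∈ LieModule.maxTrivSubmodule ℂ g V :=
    (LieModule.mem_maxTrivSubmodule ℂ g V v).mpr hv
  rcases eq_bot_or_eq_top (LieModule.maxTrivSubmodule ℂ g V) with h | h
  · rwa [h, LieSubmodule.mem_bot] at hmem
  · have : v₀ ∈ LieModule.maxTrivSubmodule ℂ g V := by rw [h]; trivial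
    exact absurd ((LieModule.mem_maxTrivSubmodule ℂ g V v₀).mp this y) h₀

end Multiplicity

/-! ### Endomorphisms of the shifted module -/

section Shifted

variable {g : Type u} [LieRing g] [LieAlgebra ℂ g] [FiniteDimensional ℂ g]
  [LieAlgebra.IsSimple ℂ g] {H : LieSubalgebra ℂ g} [H.IsCartanSubalgebra]
  {θ : H.root} {l k c a b : ℂ}
  {W : Type w} [AddCommGroup W] [Module ℂ W]
  [LieRingModule (AffineVirasoro θ) W] [LieModule ℂ (AffineVirasoro θ) W]
  {V : Type v} [AddCommGroup V] [Module ℂ V] [LieRingModule g V] [LieModule ℂ g V]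

namespace ShiftedModule

/-- The coefficient of `tⁿ`. -/
def coeff (n : ℤ) : ShiftedModule l a b W V →ₗ[ℂ] W ⊗[ℂ] V := Finsupp.lapply n

theorem coeff_mon_self (n : ℤ) (z : W ⊗[ℂ] V) : coeff n (mon l a b n z) = z :=
  Finsupp.single_eq_same

theorem coeff_mon_of_ne {m n : ℤ} (h : n ≠ m) (z : W ⊗[ℂ] V) : coeff m (mon l a b n z) = 0 :=
  Finsupp.single_eq_of_ne' h

theorem mon_injective (n : ℤ) : Function.Injective (mon l a b n : W ⊗[ℂ] V →ₗ[ℂ] _) :=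
  Finsupp.single_injective n

theorem coeff_ext {y y' : ShiftedModule l a b W V} (h : ∀ n, coeff n y = coeff n y') : y = y' :=
  Finsupp.ext h

/-- The action of `d₀` on the coefficients; it does not involve the action on `W`. -/
theorem coeff_vir_zero (n : ℤ) (y : ShiftedModule l a b W V) :
    coeff n ⁅vir θ 0, y⁆ = (l + a + n) • coeff n y := by
  suffices h : coeff n ∘ₗ LieModule.toEnd ℂ (AffineVirasoro θ) (ShiftedModule l a b W V) (vir θ 0) =
      (l + a + n : ℂ) • coeff n from LinearMap.congr_fun h y
  refine mon_ext l a b W V fun m w v => ?_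
  change coeff n (act l a b W V θ (hom θ 0 (0, 1)) (mon l a b m (w ⊗ₜ v))) =
    (l + a + n : ℂ) • coeff n (mon l a b m (w ⊗ₜ v))
  rw [act_hom, zero_add]
  by_cases h : m = n
  · subst h
    rw [coeff_mon_self, coeff_mon_self, zero_lie, TensorProduct.tmul_zero, add_zero,
      TensorProduct.smul_tmul']
    congr 1
    change ⁅vir θ 0, w⁆ + _ = _
    push_cast
    module
  · rw [coeff_mon_of_ne h, coeff_mon_of_ne h, smul_zero]

theorem lie_cur_mon (m n : ℤ) (x : g) (z : W ⊗[ℂ] V) :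
    ⁅cur θ m x, mon l a b n z⁆ = mon l a b (m + n)
      ((LieModule.toEnd ℂ (AffineVirasoro θ) W (cur θ m x)).rTensor V z +
        (LieModule.toEnd ℂ g V x).lTensor W z) := by
  induction z with
  | zero => simp only [map_zero, lie_zero, add_zero]
  | add y z hy hz =>
    rw [map_add (mon l a b n), lie_add, hy, hz]
    simp only [map_add]
    abel
  | tmul w v => rw [cur_mon]; rfl

theorem vir_mon_tmul (m n : ℤ) (w : W) (v : V) :
    ⁅vir θ m, mon l a b n (w ⊗ₜ[ℂ] v)⁆ = mon l a b (m + n)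
      ((⁅vir θ m, w⁆ + (a + n + b * m) • w - (⁅vir θ 0, w⁆ - l • w)) ⊗ₜ v) := by
  rw [lie_def, vir, act_hom, zero_lie, TensorProduct.tmul_zero, add_zero, one_smul, add_sub_assoc,
    vir]

variable {φ : End ℂ (ShiftedModule l a b W V)}

/-- An endomorphism preserves the eigenspaces `W ⊗ V ⊗ tⁿ` of `d₀`. -/
theorem eq_mon_coeff (hφ : φ ∈ LieEnd (AffineVirasoro θ) (ShiftedModule l a b W V)) (n : ℤ)
    (z : W ⊗[ℂ] V) : φ (mon l a b n z) = mon l a b n (coeff n (φ (mon l a b n z))) := by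
  rw [mem_lieEnd] at hφ
  have h1 : ⁅vir θ 0, mon l a b n z⁆ = (l + a + n : ℂ) • mon l a b n z := by
    refine coeff_ext fun m => ?_
    rw [coeff_vir_zero, map_smul]
    by_cases h : n = m
    · rw [h]
    · rw [coeff_mon_of_ne h, smul_zero, smul_zero]
  refine coeff_ext fun m => ?_
  by_cases h : n = m
  · rw [h, coeff_mon_self]
  · rw [coeff_mon_of_ne h]
    have h2 := congrArg (coeff m) (hφ (vir θ 0) (mon l a b n z))
    rw [h1, map_smul, map_smul, coeff_vir_zero, ← sub_eq_zero, ← sub_smul] at h2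
    refine (smul_eq_zero.mp h2).resolve_left fun h3 => h ?_
    have h4 : (n : ℂ) = m := by linear_combination h3
    exact_mod_cast h4

/-- The endomorphism `φ` of the shifted module maps `w ⊗ v ⊗ tⁿ` to `w' ⊗ v ⊗ tⁿ` for all `v` and
`n`. -/
def Relates (φ : End ℂ (ShiftedModule l a b W V)) (w w' : W) : Prop :=
  ∀ (n : ℤ) (v : V), φ (mon l a b n (w ⊗ₜ v)) = mon l a b n (w' ⊗ₜ v)

theorem Relates.add {w₁ w₁' w₂ w₂' : W} (h₁ : Relates φ w₁ w₁') (h₂ : Relates φ w₂ w₂') :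
    Relates φ (w₁ + w₂) (w₁' + w₂') := by
  intro n v
  rw [TensorProduct.add_tmul, TensorProduct.add_tmul, map_add, map_add, map_add, h₁, h₂]

theorem Relates.smul (r : ℂ) {w w' : W} (h : Relates φ w w') : Relates φ (r • w) (r • w') := by
  intro n v
  rw [← TensorProduct.smul_tmul', ← TensorProduct.smul_tmul', map_smul, map_smul, map_smul, h]

theorem Relates.sub {w₁ w₁' w₂ w₂' : W} (h₁ : Relates φ w₁ w₁') (h₂ : Relates φ w₂ w₂') :
    Relates φ (w₁ - w₂) (w₁' - w₂') := by
  simpa [sub_eq_add_neg] using h₁.add (h₂.smul (-1))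

theorem Relates.cur (hφ : φ ∈ LieEnd (AffineVirasoro θ) (ShiftedModule l a b W V)) {w w' : W}
    (h : Relates φ w w') (m : ℤ) (x : g) : Relates φ ⁅cur θ m x, w⁆ ⁅cur θ m x, w'⁆ := by
  rw [mem_lieEnd] at hφ
  intro n v
  have h1 := hφ (AffineVirasoro.cur θ m x) (mon l a b (n - m) (w ⊗ₜ v))
  rw [h, cur_mon, cur_mon, map_add, map_add, map_add, h, add_sub_cancel] at h1
  exact add_right_cancel h1

variable [LieModule.IsIrreducible ℂ (AffineVirasoro θ) W] {u : W}

/-- On `w ⊗ v ⊗ tⁿ` the element `dₘ` with `m` large acts through a scalar and the degree operator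
`d₀ - l` of `W`, which makes `φ` compatible with the degree operator. -/
theorem Relates.vir_zero (hu : IsVacuumVector θ l k c u)
    (hφ : φ ∈ LieEnd (AffineVirasoro θ) (ShiftedModule l a b W V)) {w w' : W}
    (h : Relates φ w w') : Relates φ ⁅vir θ 0, w⁆ ⁅vir θ 0, w'⁆ := by
  rw [mem_lieEnd] at hφ
  suffices hD : Relates φ (⁅AffineVirasoro.vir θ 0, w⁆ - l • w)
      (⁅AffineVirasoro.vir θ 0, w'⁆ - l • w') by
    simpa using hD.add (h.smul l)
  intro n v
  obtain ⟨m, hm, hm'⟩ :=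
    ((hu.eventually_lie_eq_zero w).and (hu.eventually_lie_eq_zero w')).exists
  have h1 := hφ (AffineVirasoro.vir θ m) (mon l a b (n - m) (w ⊗ₜ v))
  rw [h, vir_mon_tmul, vir_mon_tmul, AffineVirasoro.vir, hm, hm', zero_add, zero_add,
    TensorProduct.sub_tmul, TensorProduct.sub_tmul (_ • w'), map_sub, map_sub, map_sub, h.smul, add_sub_cancel] at h1
  exact sub_right_injective h1

theorem Relates.vir (hu : IsVacuumVector θ l k c u)
    (hφ : φ ∈ LieEnd (AffineVirasoro θ) (ShiftedModule l a b W V)) {w w' : W}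
    (h : Relates φ w w') (m : ℤ) : Relates φ ⁅vir θ m, w⁆ ⁅vir θ m, w'⁆ := by
  have h0 := h.vir_zero hu hφ
  rw [mem_lieEnd] at hφ
  intro n v
  have hr := (h.smul (a + (n - m : ℤ) + b * m)).sub (h0.sub (h.smul l)) n v
  have h1 := hφ (AffineVirasoro.vir θ m) (mon l a b (n - m) (w ⊗ₜ v))
  rw [h, vir_mon_tmul, vir_mon_tmul, add_sub_assoc, add_sub_assoc, TensorProduct.add_tmul,
    TensorProduct.add_tmul, map_add, map_add, map_add, add_sub_cancel, hr] at h1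
  exact add_right_cancel h1

theorem Relates.hom (hu : IsVacuumVector θ l k c u)
    (hφ : φ ∈ LieEnd (AffineVirasoro θ) (ShiftedModule l a b W V)) {w w' : W}
    (h : Relates φ w w') (m : ℤ) (X : g × ℂ) : Relates φ ⁅hom θ m X, w⁆ ⁅hom θ m X, w'⁆ := by
  rw [hom_eq, add_lie, add_lie, smul_lie, smul_lie]
  exact (h.cur hφ m X.1).add ((h.vir hu hφ m).smul X.2)

theorem eventually_rTensor_eq_zero (hu : IsVacuumVector θ l k c u) (z : W ⊗[ℂ] V) :
    ∀ᶠ m : ℤ in atTop, ∀ X,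
      (LieModule.toEnd ℂ (AffineVirasoro θ) W (AffineVirasoro.hom θ m X)).rTensor V z = 0 := by
  induction z with
  | zero => simp
  | add y z hy hz =>
    filter_upwards [hy, hz] with m h1 h2 X
    rw [map_add, h1, h2, add_zero]
  | tmul w v =>
    filter_upwards [hu.eventually_lie_eq_zero w] with m h X
    rw [LinearMap.rTensor_tmul, LieModule.toEnd_apply_apply, h, TensorProduct.zero_tmul]

/-- For `N` large, `φ(u ⊗ x v ⊗ t^N)` is determined by `φ(u ⊗ v ⊗ tⁿ)` for any single `n`. -/
theorem eventually_coeff_eq (hu : IsVacuumVector θ l k c u)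
    (hφ : φ ∈ LieEnd (AffineVirasoro θ) (ShiftedModule l a b W V)) (n : ℤ) (x : g) (v : V) :
    ∀ᶠ N : ℤ in atTop, coeff N (φ (mon l a b N (u ⊗ₜ ⁅x, v⁆))) =
      (LieModule.toEnd ℂ g V x).lTensor W (coeff n (φ (mon l a b n (u ⊗ₜ v)))) := by
  have hshift : Tendsto (fun N : ℤ => N - n) atTop atTop :=
    tendsto_atTop_add_const_right atTop (-n) tendsto_id
  filter_upwards [hshift.eventually (eventually_rTensor_eq_zero hu
    (coeff n (φ (mon l a b n (u ⊗ₜ v))))), eventually_gt_atTop n] with N hN hn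
  have h1 := (mem_lieEnd.mp hφ) (AffineVirasoro.cur θ (N - n) x) (mon l a b n (u ⊗ₜ v))
  rw [eq_mon_coeff hφ n, cur_mon, lie_cur_mon, AffineVirasoro.cur, hN,
    hu.pos (N - n) (by omega), TensorProduct.zero_tmul, zero_add, zero_add, sub_add_cancel] at h1
  rw [h1, coeff_mon_self]

/-- The vectors `φ(u ⊗ v ⊗ tⁿ)` do not depend on `n` up to the power of `t`, because `V` has no
invariants, and they depend equivariantly on `v`. -/
theorem exists_relates_vacuum [FiniteDimensional ℂ V] [LieModule.IsIrreducible ℂ g V]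
    (hV : ∀ v : V, (∀ x : g, ⁅x, v⁆ = 0) → v = 0) (hu : IsVacuumVector θ l k c u)
    (hφ : φ ∈ LieEnd (AffineVirasoro θ) (ShiftedModule l a b W V)) :
    ∃ u', Relates φ u u' := by
  have hconst : ∀ (m n : ℤ) (v : V), coeff m (φ (mon l a b m (u ⊗ₜ v))) =
      coeff n (φ (mon l a b n (u ⊗ₜ v))) := by
    intro m n v
    refine eq_of_forall_lTensor_eq hV fun x => ?_
    obtain ⟨N, h1, h2⟩ :=
      ((eventually_coeff_eq hu hφ m x v).and (eventually_coeff_eq hu hφ n x v)).exists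
    rw [← h1, ← h2]
  let T : V →ₗ[ℂ] W ⊗[ℂ] V := coeff 0 ∘ₗ φ ∘ₗ mon l a b 0 ∘ₗ TensorProduct.mk ℂ W V u
  have hT : ∀ n v, coeff n (φ (mon l a b n (u ⊗ₜ v))) = T v := fun n v => hconst n 0 v
  obtain ⟨u', hu'⟩ := exists_eq_tmul (g := g) T (by
    intro x v
    obtain ⟨N, hN⟩ := (eventually_coeff_eq hu hφ 0 x v).exists
    rwa [hT, hT] at hN)
  refine ⟨u', fun n v => ?_⟩
  rw [eq_mon_coeff hφ, hT, hu']

theorem forall_scalar [FiniteDimensional ℂ V] [LieModule.IsIrreducible ℂ g V]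
    (hV : ∀ v : V, (∀ x : g, ⁅x, v⁆ = 0) → v = 0) (hu : IsVacuumVector θ l k c u) :
    ∀ φ ∈ LieEnd (AffineVirasoro θ) (ShiftedModule l a b W V), ∃ r : ℂ, ∀ y, φ y = r • y := by
  intro φ hφ
  have : Nontrivial V := LieModule.nontrivial_of_isIrreducible ℂ g V
  obtain ⟨v₁, hv₁⟩ := exists_ne (0 : V)
  obtain ⟨ξ, hξ⟩ := Module.Projective.exists_dual_eq_one ℂ hv₁
  let f : End ℂ W :=
    contractSnd ξ ∘ₗ coeff 0 ∘ₗ φ ∘ₗ mon l a b 0 ∘ₗ (TensorProduct.mk ℂ W V).flip v₁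
  have hf : ∀ {w w'}, Relates φ w w' → f w = w' := by
    intro w w' h
    change contractSnd ξ (coeff 0 (φ (mon l a b 0 (w ⊗ₜ v₁)))) = w'
    rw [h, coeff_mon_self, contractSnd_tmul, hξ, one_smul]
  let P : Submodule ℂ W :=
    { carrier := {w | ∃ w', Relates φ w w'}
      zero_mem' := ⟨0, fun n v => by simp⟩
      add_mem' := fun ⟨_, h⟩ ⟨_, h'⟩ => ⟨_, h.add h'⟩
      smul_mem' := fun r _ ⟨_, h⟩ => ⟨_, h.smul r⟩ }
  have hP : ∀ w, Relates φ w (f w) := by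
    intro w
    obtain ⟨w', hw'⟩ : w ∈ P := hu.mem_of_stable P (exists_relates_vacuum hV hu hφ)
      (fun n X _ ⟨_, h⟩ => ⟨_, h.hom hu hφ n X⟩) w
    rwa [hf hw']
  have hfL : f ∈ LieEnd (AffineVirasoro θ) W := by
    rw [mem_lieEnd]
    intro x w
    suffices h : f ∘ₗ (LieModule.toEnd ℂ (AffineVirasoro θ) W :
          AffineVirasoro θ →ₗ[ℂ] End ℂ W).flip w =
        (LieModule.toEnd ℂ (AffineVirasoro θ) W : AffineVirasoro θ →ₗ[ℂ] End ℂ W).flip (f w) from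
      LinearMap.congr_fun h x
    apply AffineVirasoro.hom_ext
    · intro n X
      exact hf ((hP w).hom hu hφ n X)
    · change f ⁅K θ, w⁆ = ⁅K θ, f w⁆
      rw [hu.K_lie, hu.K_lie, map_smul]
    · change f ⁅C θ, w⁆ = ⁅C θ, f w⁆
      rw [hu.C_lie, hu.C_lie, map_smul]
  obtain ⟨r, hr⟩ := AffineVirasoro.forall_scalar_of_isIrreducible W f hfL
  refine ⟨r, fun y => ?_⟩
  suffices h : φ = r • LinearMap.id from LinearMap.congr_fun h y
  refine mon_ext l a b W V fun n w v => ?_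
  rw [hP w n v, hr, ← TensorProduct.smul_tmul', map_smul]
  rfl

end ShiftedModule

end Shifted

/-! ### Irreducible quotients of Verma modules -/

theorem isIrreducible_quotient_of_isCoatom {L : Type u} {M : Type v} [LieRing L] [LieAlgebra ℂ L]
    [AddCommGroup M] [Module ℂ M] [LieRingModule L M] [LieModule ℂ L M] {J : LieSubmodule ℂ L M}
    (hJ : IsCoatom J) : LieModule.IsIrreducible ℂ L (M ⧸ J) := by
  have : Nontrivial (M ⧸ J) := by
    obtain ⟨m, hm⟩ : ∃ m, m ∉ J := by
      by_contra! h
      exact hJ.1 (eq_top_iff.mpr fun m _ => h m)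
    exact ⟨⟨LieSubmodule.Quotient.mk' J m, 0, fun h => hm (LieSubmodule.Quotient.mk_eq_zero'.mp h)⟩⟩
  refine LieModule.IsIrreducible.mk fun N hN => ?_
  obtain ⟨q, hq, hq0⟩ : ∃ q ∈ N, q ≠ 0 := by
    by_contra! h
    exact hN ((LieSubmodule.eq_bot_iff N).mpr h)
  obtain ⟨m, rfl⟩ := LieSubmodule.Quotient.surjective_mk' J q
  have hlt : J < N.comap (LieSubmodule.Quotient.mk' J) := by
    refine lt_of_le_of_ne (fun x hx => ?_) fun h => hq0 ?_
    · have h0 : LieSubmodule.Quotient.mk' J x = 0 := LieSubmodule.Quotient.mk_eq_zero'.mpr hx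
      rw [LieSubmodule.mem_comap, h0]
      exact N.zero_mem
    · refine LieSubmodule.Quotient.mk_eq_zero'.mpr ?_
      rw [h]
      exact hq
  have htop := hJ.2 _ hlt
  rw [eq_top_iff]
  rintro q -
  obtain ⟨m, rfl⟩ := LieSubmodule.Quotient.surjective_mk' J q
  have : m ∈ N.comap (LieSubmodule.Quotient.mk' J) := by rw [htop]; trivial
  exact this

section Verma

variable {g : Type u} [LieRing g] [LieAlgebra ℂ g] [FiniteDimensional ℂ g]
  [LieAlgebra.IsSimple ℂ g] {H : LieSubalgebra ℂ g} [H.IsCartanSubalgebra]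
  {Φ : (rootSystem H).Base} {θ : H.root} {lam : Dual ℂ H} {l k c : ℂ}

namespace VermaModule

/-- The elements of the enveloping algebra that preserve a submodule form a subalgebra, which
contains the Lie algebra and is thus everything. -/
theorem smul_mem_of_lieSubmodule
    (N : LieSubmodule ℂ (AffineVirasoro θ) (VermaModule Φ θ lam l k c))
    (r : UniversalEnvelopingAlgebra ℂ (AffineVirasoro θ)) {m : VermaModule Φ θ lam l k c}
    (hm : m ∈ N) : r • m ∈ N := by
  let _ : LieRing (UniversalEnvelopingAlgebra ℂ (AffineVirasoro θ)) := LieRing.ofAssociativeRing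
  let A : Subalgebra ℂ (UniversalEnvelopingAlgebra ℂ (AffineVirasoro θ)) :=
    { carrier := {r | ∀ m ∈ N, r • m ∈ N}
      mul_mem' := by
        intro r s hr hs m hm
        rw [mul_smul]
        exact hr _ (hs _ hm)
      add_mem' := by
        intro r s hr hs m hm
        rw [add_smul]
        exact N.add_mem (hr _ hm) (hs _ hm)
      algebraMap_mem' := by
        intro t m hm
        rw [algebraMap_smul]
        exact N.smul_mem t hm }
  let _ : LieRing A := LieRing.ofAssociativeRing
  let f : AffineVirasoro θ →ₗ⁅ℂ⁆ A :=
    { toFun := fun x => ⟨UniversalEnvelopingAlgebra.ι ℂ x, fun m hm => N.lie_mem hm⟩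
      map_add' := fun x y => Subtype.ext (map_add _ x y)
      map_smul' := fun t x => Subtype.ext (map_smul _ t x)
      map_lie' := fun {x y} => Subtype.ext (LieHom.map_lie _ x y) }
  have h : A.val.comp (UniversalEnvelopingAlgebra.lift ℂ f) = AlgHom.id ℂ _ := by
    apply UniversalEnvelopingAlgebra.hom_ext
    ext x
    change ((UniversalEnvelopingAlgebra.lift ℂ f (UniversalEnvelopingAlgebra.ι ℂ x) : A) :
      UniversalEnvelopingAlgebra ℂ (AffineVirasoro θ)) = UniversalEnvelopingAlgebra.ι ℂ x
    rw [UniversalEnvelopingAlgebra.lift_ι_apply]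
    rfl
  have hr : ((UniversalEnvelopingAlgebra.lift ℂ f r : A) :
      UniversalEnvelopingAlgebra ℂ (AffineVirasoro θ)) = r := DFunLike.congr_fun h r
  have := (UniversalEnvelopingAlgebra.lift ℂ f r).2 m hm
  rwa [hr] at this

theorem eq_top_of_vac_mem {N : LieSubmodule ℂ (AffineVirasoro θ) (VermaModule Φ θ lam l k c)}
    (h : vac Φ θ lam l k c ∈ N) : N = ⊤ := by
  rw [eq_top_iff]
  rintro m -
  obtain ⟨r, rfl⟩ := Submodule.Quotient.mk_surjective _ m
  have := smul_mem_of_lieSubmodule N r h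
  rw [vac] at this
  change Submodule.Quotient.mk (r • 1) ∈ N at this
  rwa [smul_eq_mul, mul_one] at this

theorem smul_vac_of_rel {y : UniversalEnvelopingAlgebra ℂ (AffineVirasoro θ)}
    (h : VermaRel Φ θ lam l k c y) : y • vac Φ θ lam l k c = 0 := by
  refine (Submodule.Quotient.mk_eq_zero (vermaIdeal Φ θ lam l k c)).mpr ?_
  change y * 1 ∈ _
  rw [mul_one]
  exact Submodule.subset_span h

theorem lie_vac_of_rel {x : AffineVirasoro θ} {r : ℂ} (h : VermaRel Φ θ lam l k c
    (UniversalEnvelopingAlgebra.ι ℂ x - algebraMap ℂ _ r)) :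
    ⁅x, vac Φ θ lam l k c⁆ = r • vac Φ θ lam l k c := by
  have := smul_vac_of_rel h
  rwa [sub_smul, algebraMap_smul, sub_eq_zero] at this

theorem isVacuumVector_mk {J : LieSubmodule ℂ (AffineVirasoro θ) (VermaModule Φ θ lam l k c)}
    (hJ : IsCoatom J) :
    IsVacuumVector θ l k c (LieSubmodule.Quotient.mk' J (vac Φ θ lam l k c)) where
  ne_zero h := hJ.1 (eq_top_of_vac_mem (LieSubmodule.Quotient.mk_eq_zero'.mp h))
  d_zero := by rw [← LieModuleHom.map_lie, lie_vac_of_rel .d_zero, map_smul]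
  level := by rw [← LieModuleHom.map_lie, lie_vac_of_rel .level, map_smul]
  charge := by rw [← LieModuleHom.map_lie, lie_vac_of_rel .charge, map_smul]
  pos n hn X := by
    have hcur : ⁅cur θ n X.1, vac Φ θ lam l k c⁆ = 0 := smul_vac_of_rel (.cur_pos n hn X.1)
    have hvir : ⁅vir θ n, vac Φ θ lam l k c⁆ = 0 := smul_vac_of_rel (.vir_pos n hn)
    rw [← LieModuleHom.map_lie, hom_eq, add_lie, smul_lie, hcur, hvir, smul_zero, add_zero, map_zero]

end VermaModule

end Verma
end

/-- Let `J` be the maximal proper submodule of the Verma module `M(λ, l, k, c)`, so that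
`L(λ, l, k, c) = M(λ, l, k, c) / J`, and let `V = L(μ)` be the finite-dimensional irreducible
`g`-module with highest weight `μ ≠ 0`.  Then `L(λ, l, k, c) ⊗ L_{a,b}(μ)` is isomorphic to the shifted
module by the map `w ⊗ v ⊗ tⁿ ↦ w ⊗ v ⊗ t^(n + deg w)`; both modules have endomorphism algebra `ℂ`,
and both are indecomposable. -/
theorem theorem3p2 {g : Type u} [LieRing g] [LieAlgebra ℂ g] [FiniteDimensional ℂ g]
    [LieAlgebra.IsSimple ℂ g] (H : LieSubalgebra ℂ g) [H.IsCartanSubalgebra]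
    (Φ : (rootSystem H).Base) (θ : H.root) (hθ : IsHighestRoot Φ θ)
    (lam : Dual ℂ H) (l k c a b : ℂ)
    (J : LieSubmodule ℂ (AffineVirasoro θ) (VermaModule Φ θ lam l k c)) (hJ : IsCoatom J)
    {V : Type v} [AddCommGroup V] [Module ℂ V] [LieRingModule g V] [LieModule ℂ g V]
    [FiniteDimensional ℂ V] [LieModule.IsIrreducible ℂ g V]
    (μ : Dual ℂ H) (vμ : V) (hvμ : IsHighestWeightVector Φ μ vμ) (hμ : μ ≠ 0) :
    (∃ e : (VermaModule Φ θ lam l k c ⧸ J) ⊗[ℂ] LoopModule a b V ≃ₗ⁅ℂ, AffineVirasoro θ⁆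
        ShiftedModule l a b (VermaModule Φ θ lam l k c ⧸ J) V,
      ∀ (p n : ℤ) (w : VermaModule Φ θ lam l k c ⧸ J) (v : V),
        ⁅AffineVirasoro.vir θ 0, w⁆ = (l + p) • w →
          e (w ⊗ₜ LoopModule.mon a b n v) = ShiftedModule.mon l a b (n + p) (w ⊗ₜ v)) ∧
    Nonempty (LieEnd (AffineVirasoro θ)
      (ShiftedModule l a b (VermaModule Φ θ lam l k c ⧸ J) V) ≃ₐ[ℂ] ℂ) ∧
    Nonempty (LieEnd (AffineVirasoro θ)
      ((VermaModule Φ θ lam l k c ⧸ J) ⊗[ℂ] LoopModule a b V) ≃ₐ[ℂ] ℂ) ∧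
    IsIndecomposable (AffineVirasoro θ)
      (ShiftedModule l a b (VermaModule Φ θ lam l k c ⧸ J) V) ∧
    IsIndecomposable (AffineVirasoro θ)
      ((VermaModule Φ θ lam l k c ⧸ J) ⊗[ℂ] LoopModule a b V) := by
  have hirr := isIrreducible_quotient_of_isCoatom hJ
  have hu := VermaModule.isVacuumVector_mk hJ
  -- The weight `μ ≠ 0` excludes the trivial module, the only irreducible one with invariants.
  have hV : ∀ v : V, (∀ x : g, ⁅x, v⁆ = 0) → v = 0 := by
    obtain ⟨h, hh⟩ : ∃ h, μ h ≠ 0 := by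
      by_contra! h0
      exact hμ (LinearMap.ext h0)
    refine fun v hv => eq_zero_of_forall_lie_eq_zero (y := (h : g)) (v₀ := vμ) ?_ v hv
    rw [hvμ.weight]
    exact smul_ne_zero hh hvμ.ne_zero
  obtain ⟨e, he⟩ := exists_loop_equiv_shifted a b hu V
  have hS := ShiftedModule.forall_scalar (a := a) (b := b) hV hu
  have hT := forall_scalar_of_equiv e hS
  have : Nontrivial V := ⟨⟨vμ, 0, hvμ.ne_zero⟩⟩
  have : Nontrivial (VermaModule Φ θ lam l k c ⧸ J) := ⟨⟨_, 0, hu.ne_zero⟩⟩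
  have hnS : Nontrivial (ShiftedModule l a b (VermaModule Φ θ lam l k c ⧸ J) V) :=
    (ShiftedModule.mon_injective (0 : ℤ)).nontrivial
  have hnT : Nontrivial ((VermaModule Φ θ lam l k c ⧸ J) ⊗[ℂ] LoopModule a b V) :=
    e.toEquiv.nontrivial
  exact ⟨⟨e, he⟩, lieEnd_equiv_of_forall_scalar hS, lieEnd_equiv_of_forall_scalar hT,
    isIndecomposable_of_forall_scalar hS, isIndecomposable_of_forall_scalar hT⟩
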